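/- For $\tau$ in the upper half-plane let $\eta(\tau)=e^{i\pi\tau/12}\prod_{n\ge 1}(1-e^{2\pi i n\tau})$ be the Dedekind eta function and let $\lambda(\tau)=\theta_2(\tau)^4/\theta_3(\tau)^4$ be the modular $\lambda$-function, where $\theta_2(\tau)=\sum_{n\in\mathbb Z}e^{\pi i(n+1/2)^2\tau}$ and $\theta_3(\tau)=\sum_{n\in\mathbb Z}e^{\pi i n^2\tau}$. Let $\Omega$ be the connected component of $\{\tau : \operatorname{Im}\tau>0,\ |\lambda(\tau)|<1\}$ that contains $i$. Then $\Omega$ contains the half-axis $\{it : t>0\}$ and a half-plane $\{\operatorname{Im}\tau>Y\}$, and there is a holomorphic branch $\left(\tfrac12\lambda(1-\lambda)\right)^{1/3}$ of the cube root on $\Omega$ that is real and positive on $\{it: t>0\}$. For every $\tau\in\Omega$ the integral of $\eta^4$ along the vertical ray from $i\infty$ to $\tau$ converges absolutely, the continued fraction below converges, and $$\int_{\infty}^{\tau}\eta^4(z)\,dz=\frac{3}{2\pi i}\left(\tfrac12\lambda(1-\lambda)\right)^{1/3}\cdot\cfrac{1}{1-\cfrac{n_1\lambda}{1-\cfrac{n_2\lambda}{1-\cdots}}},\qquad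 \lambda=\lambda(\tau),$$ where $$n_{2k+1}=\frac{k+\frac13}{2\left(2k+\frac13\right)}\quad(k\ge 0),\qquad n_{2k}=\frac{k}{2\left(2k+\frac13\right)}\quad(k\ge 1).$$ -/

import Mathlib

open Complex Filter Topology MeasureTheory

noncomputable section

namespace Hexp

/-- The theta constant `θ₂(τ) = ∑_{n ∈ ℤ} exp(π i (n + 1/2)² τ)`
(the series is `theta2_eq_tsum` below). -/
def theta2 (τ : ℂ) : ℂ := cexp (Real.pi * I * τ / 4) * jacobiTheta₂ (τ / 2) τ

theorem theta2_eq_tsum (τ : ℂ) :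
    theta2 τ = ∑' n : ℤ, cexp (Real.pi * I * ((n : ℂ) + 1 / 2) ^ 2 * τ) := by
  unfold theta2 jacobiTheta₂
  rw [← tsum_mul_left]
  refine tsum_congr fun n => ?_
  rw [jacobiTheta₂_term, ← Complex.exp_add]
  congr 1
  ring

/-- The theta constant `θ₃(τ) = ∑_{n ∈ ℤ} exp(π i n² τ)`. -/
def theta3 (τ : ℂ) : ℂ := jacobiTheta τ

/-- The modular lambda function `λ = θ₂⁴ / θ₃⁴` (for `Im τ > 0`). -/
def modularLambda (τ : ℂ) : ℂ := theta2 τ ^ 4 / theta3 τ ^ 4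

/-- The connected component, containing `i`, of the set of all `τ` in the upper half-plane
with `|λ(τ)| < 1`. -/
def cuspDomain : Set ℂ :=
  connectedComponentIn {τ : ℂ | 0 < τ.im ∧ ‖modularLambda τ‖ < 1} I

/-- `∫_∞^τ η⁴(z) dz`, taken down the vertical ray `z = τ + i t` from `t = ∞` to `t = 0`. -/
def etaFourPrimitive (τ : ℂ) : ℂ :=
  -∫ t in Set.Ioi (0 : ℝ), ModularForm.eta (τ + t * I) ^ 4 * I

/-- The coefficients `n_m`, `m ≥ 1`, of the continued fraction
(see `coeff_odd` and `coeff_even`); the value at `m = 0` is not used. -/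
def coeff (m : ℕ) : ℂ :=
  if Even m then ((m / 2 : ℕ) : ℂ) / (2 * (2 * ((m / 2 : ℕ) : ℂ) + 1 / 3))
  else (((m / 2 : ℕ) : ℂ) + 1 / 3) / (2 * (2 * ((m / 2 : ℕ) : ℂ) + 1 / 3))

theorem coeff_odd (k : ℕ) :
    coeff (2 * k + 1) = ((k : ℂ) + 1 / 3) / (2 * (2 * (k : ℂ) + 1 / 3)) := by
  have h : ¬ Even (2 * k + 1) := by simp
  have h2 : (2 * k + 1) / 2 = k := by omega
  rw [coeff, if_neg h, h2]

theorem coeff_even (k : ℕ) : coeff (2 * k) = (k : ℂ) / (2 * (2 * (k : ℂ) + 1 / 3)) := by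
  have h : Even (2 * k) := even_two_mul k
  have h2 : 2 * k / 2 = k := by omega
  rw [coeff, if_pos h, h2]

/-- The infinite continued fraction `1 / (1 - n₁ x / (1 - n₂ x / (1 - ⋯)))`. -/
def gaussFraction (x : ℂ) : GenContFract ℂ where
  h := 0
  s := Stream'.Seq.ofStream fun m => ⟨if m = 0 then 1 else -(coeff m * x), 1⟩

/-- A continued fraction converges to `L`: all but finitely many of its convergents have nonzero
denominator, and the convergents tend to `L`. -/
def ConvergesTo (g : GenContFract ℂ) (L : ℂ) : Prop :=
  (∀ᶠ N in atTop, g.dens N ≠ 0) ∧ Tendsto (fun N => g.convs N) atTop (𝓝 L)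

end Hexp

end

/-!
Both sides of the formula are primitives of `η⁴` that vanish at `i∞`, so they agree on a connected
open set reaching up to the cusp.

For the right-hand side, the continued fraction is Gauss's continued fraction of
`F(z) = ₂F₁(2/3, 1; 4/3; z)`. The contiguous series `F_i` (`tailSeries`) satisfy the three-term
recurrence `F_i = F_{i+1} - n_{i+1} z F_{i+2}` with `F_0 = 1`, which expresses the error
`F B_N - A_N` of the `N`-th convergent as `n_1 ⋯ n_N z ^ N F_{N+1}(z)`, a power series with
nonnegative coefficients. The `n_m` form a chain sequence `n_m = (1 - g_{m-1}) g_m` with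
`0 ≤ g_m < 1`; hence for real `0 < x < 1` the numerators and denominators are positive, and
`|B_N(z)| ≥ B_N(x)` when `|z| ≤ x`. Comparing the errors at `z` and at `x` gives convergence at the
rate `(|z| / x) ^ N` on the whole open disc (`gaussFraction_convergesTo`). The series also satisfies
a first-order equation (`exists_hasDerivAt_tailSeries_one`), which says that
`(z (1 - z)) ^ (1/3) F(z)` is a primitive of `(z (1 - z)) ^ (-2/3) / 3`.

To compose with `z = λ(τ)`, three identities are needed: Jacobi's identity `θ₃⁴ = θ₂⁴ + θ₄⁴`, the
product formula `(θ₂ θ₃ θ₄)⁴ = 16 η¹²`, and the differential equation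
`λ' = π i λ (1 - λ) θ₃⁴`. Each of them says that a certain holomorphic function on the upper
half-plane is constant; the function is invariant under `τ ↦ τ + 1` and `τ ↦ -1/τ` and has a limit
at `i∞`, so it is a modular form of level one and weight zero (`eq_of_modular_invariant`). By the
first two identities `2 η⁴ / θ₃⁴` is a cube root of `λ (1 - λ) / 2`, holomorphic on the whole upper
half-plane and positive on the imaginary axis; with the third, the right-hand side is a primitive of
`η⁴` wherever `|λ| < 1` (`hasDerivAt_cubeRoot_mul_tailSeries`).
-/

noncomputable section

namespace Hexp

/-! ### Hypergeometric series and their contiguity relation -/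

/-- The coefficients `(a)_j (b)_j / ((c)_j j!)` of Gauss's hypergeometric series
`₂F₁(a, b; c; z)`, given by their recursion in `j`. -/
def gaussCoeff (a b c : ℝ) : ℕ → ℝ
  | 0 => 1
  | j + 1 => gaussCoeff a b c j * ((a + j) * (b + j) / ((c + j) * (1 + j)))

lemma gaussCoeff_nonneg {a b c : ℝ} (ha : 0 ≤ a) (hb : 0 ≤ b) (hc : 0 < c) (j : ℕ) :
    0 ≤ gaussCoeff a b c j := by
  induction j with
  | zero => simp [gaussCoeff]
  | succ j ih => rw [gaussCoeff]; positivity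

lemma gaussCoeff_comm (a b c : ℝ) (j : ℕ) : gaussCoeff a b c j = gaussCoeff b a c j := by
  induction j with
  | zero => rfl
  | succ j ih => rw [gaussCoeff, gaussCoeff, ih, mul_comm (a + j)]

lemma gaussCoeff_succ_eq_shift {c : ℝ} (a b : ℝ) (hc : 0 < c) (j : ℕ) :
    gaussCoeff a b c (j + 1) =
      gaussCoeff (a + 1) (b + 1) (c + 2) j * (a * b * (c + 1 + j) / (c * (c + 1) * (j + 1))) := by
  induction j with
  | zero => simp [gaussCoeff]; field_simp
  | succ j ih =>
    rw [gaussCoeff, ih, gaussCoeff]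
    push_cast
    have : c + 1 + j ≠ 0 := by positivity
    have : c + (j + 1) ≠ 0 := by positivity
    have : c + 2 + j ≠ 0 := by positivity
    field_simp
    ring

lemma gaussCoeff_succ_eq_shift_right {c : ℝ} (a b : ℝ) (hc : 0 < c) (j : ℕ) :
    gaussCoeff a (b + 1) (c + 1) (j + 1) =
      gaussCoeff (a + 1) (b + 1) (c + 2) j * (a * (b + 1 + j) / ((c + 1) * (j + 1))) := by
  induction j with
  | zero => simp [gaussCoeff]
  | succ j ih =>
    rw [gaussCoeff, ih, gaussCoeff]
    push_cast
    have : c + 1 + (j + 1) ≠ 0 := by positivity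
    have : c + 2 + j ≠ 0 := by positivity
    field_simp
    ring

/-- Gauss's contiguity relation
`F(a, b; c) = F(a, b + 1; c + 1) - a (c - b) / (c (c + 1)) z F(a + 1, b + 1; c + 2)`,
coefficient by coefficient. -/
lemma gaussCoeff_contiguous {c : ℝ} (a b : ℝ) (hc : 0 < c) (j : ℕ) :
    gaussCoeff a b c (j + 1) = gaussCoeff a (b + 1) (c + 1) (j + 1) -
      a * (c - b) / (c * (c + 1)) * gaussCoeff (a + 1) (b + 1) (c + 2) j := by
  rw [gaussCoeff_succ_eq_shift a b hc, gaussCoeff_succ_eq_shift_right a b hc]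
  field_simp
  ring

/-- The real number underlying the coefficient `n_m` of the continued fraction. -/
def fracCoeff (m : ℕ) : ℝ :=
  if Even m then ((m / 2 : ℕ) : ℝ) / (2 * (2 * ((m / 2 : ℕ) : ℝ) + 1 / 3))
  else (((m / 2 : ℕ) : ℝ) + 1 / 3) / (2 * (2 * ((m / 2 : ℕ) : ℝ) + 1 / 3))

lemma ofReal_fracCoeff (m : ℕ) : (fracCoeff m : ℂ) = coeff m := by
  unfold fracCoeff coeff
  split_ifs <;> push_cast <;> rfl

lemma fracCoeff_nonneg (m : ℕ) : 0 ≤ fracCoeff m := by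
  unfold fracCoeff
  split_ifs <;> positivity

/-- The coefficients of the series `F_i` in the chain of contiguous hypergeometric series
`F_{2k} = ₂F₁(2/3 + k, k; 1/3 + 2k)`, `F_{2k+1} = ₂F₁(2/3 + k, k + 1; 4/3 + 2k)`;
rounded-down halves of `i` and `i + 1` cover both parities. -/
def tailCoeff (i : ℕ) : ℕ → ℝ :=
  gaussCoeff (2 / 3 + (i / 2 : ℕ)) ((i + 1) / 2 : ℕ) (1 / 3 + i)

lemma tailCoeff_zero (i : ℕ) : tailCoeff i 0 = 1 := rfl

lemma tailCoeff_nonneg (i j : ℕ) : 0 ≤ tailCoeff i j :=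
  gaussCoeff_nonneg (by positivity) (by positivity) (by positivity) j

lemma tailCoeff_succ (i j : ℕ) : tailCoeff i (j + 1) =
    tailCoeff (i + 1) (j + 1) - fracCoeff (i + 1) * tailCoeff (i + 2) j := by
  rcases Nat.even_or_odd' i with ⟨k, rfl | rfl⟩
  · have e1 : 2 * k / 2 = k := by omega
    have e2 : (2 * k + 1) / 2 = k := by omega
    have e3 : (2 * k + 1 + 1) / 2 = k + 1 := by omega
    have e5 : (2 * k + 2 + 1) / 2 = k + 1 := by omega
    have e6 : ¬ Even (2 * k + 1) := by simp
    simp only [tailCoeff, fracCoeff, e1, e2, e3, e5, e6, if_false]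
    have := gaussCoeff_contiguous (2 / 3 + k) k (c := 1 / 3 + 2 * k) (by positivity) j
    push_cast
    rw [this]
    have h1 : (2 / 3 + k : ℝ) * (1 / 3 + 2 * k - k) / ((1 / 3 + 2 * k) * (1 / 3 + 2 * k + 1)) =
        (k + 1 / 3) / (2 * (2 * k + 1 / 3)) := by
      field_simp
      ring
    rw [h1]
    ring_nf
  · have e1 : (2 * k + 1) / 2 = k := by omega
    have e2 : (2 * k + 1 + 1) / 2 = k + 1 := by omega
    have e3 : (2 * k + 1 + 1 + 1) / 2 = k + 1 := by omega
    have e5 : (2 * k + 1 + 2 + 1) / 2 = k + 2 := by omega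
    have e6 : Even (2 * k + 1 + 1) := ⟨k + 1, by ring⟩
    simp only [tailCoeff, fracCoeff, e1, e2, e3, e5, e6, if_true]
    have := gaussCoeff_contiguous (k + 1) (2 / 3 + k) (c := 1 / 3 + (2 * k + 1)) (by positivity) j
    push_cast
    rw [gaussCoeff_comm _ (k + 1 : ℝ), this, gaussCoeff_comm (k + 1 : ℝ),
      gaussCoeff_comm (k + 1 + 1 : ℝ)]
    have h1 : (k + 1 : ℝ) * (1 / 3 + (2 * k + 1) - (2 / 3 + k)) /
        ((1 / 3 + (2 * k + 1)) * (1 / 3 + (2 * k + 1) + 1)) =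
        (k + 1) / (2 * (2 * (k + 1) + 1 / 3)) := by
      field_simp
      ring
    rw [h1]
    ring_nf

lemma tailCoeff_zero_succ (j : ℕ) : tailCoeff 0 (j + 1) = 0 := by
  unfold tailCoeff
  induction j with
  | zero => simp [gaussCoeff]
  | succ j ih => rw [gaussCoeff, ih, zero_mul]

variable {𝕜 : Type*} [RCLike 𝕜]

lemma summable_tailCoeff (i : ℕ) {z : 𝕜} (hz : ‖z‖ < 1) :
    Summable fun j => tailCoeff i j • z ^ j := by
  -- For `i = 0` the ratio test does not apply: the series is the constant `1`.
  rcases Nat.eq_zero_or_pos i with rfl | hi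
  · refine summable_of_ne_finset_zero (s := {0}) fun j hj => ?_
    obtain ⟨k, rfl⟩ := Nat.exists_eq_succ_of_ne_zero (by simpa using hj)
    rw [Nat.succ_eq_add_one, tailCoeff_zero_succ, zero_smul]
  by_cases hz0 : z = 0
  · refine summable_of_ne_finset_zero (s := {0}) fun j hj => ?_
    rw [hz0, zero_pow (by simpa using hj), smul_zero]
  set a : ℝ := 2 / 3 + (i / 2 : ℕ) with ha
  set b : ℝ := (((i + 1) / 2 : ℕ) : ℝ) with hb
  set c : ℝ := 1 / 3 + i with hc
  have hb0 : 0 < b := by rw [hb]; exact_mod_cast (by omega : 0 < (i + 1) / 2)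
  have ha0 : 0 < a := by positivity
  have hc0 : 0 < c := by positivity
  have hpos : ∀ j, 0 < tailCoeff i j := by
    intro j
    change 0 < gaussCoeff a b c j
    induction j with
    | zero => simp [gaussCoeff]
    | succ j ih => rw [gaussCoeff]; positivity
  have hlim : Tendsto (fun j : ℕ => (a + j) * (b + j) / ((c + j) * (1 + j)) * ‖z‖) atTop
      (𝓝 (1 * 1 * ‖z‖)) := by
    have key : ∀ u v : ℝ, 0 < v → Tendsto (fun j : ℕ => (u + j) / (v + j)) atTop (𝓝 1) := by
      intro u v hv
      have h1 : Tendsto (fun j : ℕ => (u - v) / (v + j)) atTop (𝓝 0) :=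
        tendsto_const_nhds.div_atTop
          (tendsto_atTop_add_const_left _ _ tendsto_natCast_atTop_atTop)
      have h2 := h1.const_add 1
      rw [add_zero] at h2
      refine h2.congr fun j => ?_
      have : v + j ≠ 0 := by positivity
      field_simp
      ring
    refine (((key a c hc0).mul (key b 1 one_pos)).mul_const ‖z‖).congr fun j => ?_
    rw [div_mul_div_comm]
  rw [one_mul, one_mul] at hlim
  refine summable_of_ratio_test_tendsto_lt_one hz (Eventually.of_forall fun j => ?_)
    (hlim.congr fun j => ?_)
  · simp [hz0, (hpos j).ne']
  · rw [norm_smul, norm_smul, norm_pow, norm_pow, Real.norm_of_nonneg (hpos _).le,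
      Real.norm_of_nonneg (hpos _).le]
    have : tailCoeff i (j + 1) = tailCoeff i j * ((a + j) * (b + j) / ((c + j) * (1 + j))) := rfl
    rw [this, pow_succ]
    have h1 := (hpos j).ne'
    have h2 : ‖z‖ ≠ 0 := by simpa using hz0
    field_simp

/-- The sum `F_i(z)` of the hypergeometric series with coefficients `tailCoeff i`. -/
def tailSeries (i : ℕ) (z : 𝕜) : 𝕜 := ∑' j, tailCoeff i j • z ^ j

lemma tailSeries_zero_left (z : 𝕜) : tailSeries 0 z = 1 := by
  unfold tailSeries
  rw [tsum_eq_single 0]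
  · simp [tailCoeff_zero]
  · intro j hj
    obtain ⟨k, rfl⟩ := Nat.exists_eq_succ_of_ne_zero hj
    rw [Nat.succ_eq_add_one, tailCoeff_zero_succ, zero_smul]

lemma tailSeries_eq (i : ℕ) {z : 𝕜} (hz : ‖z‖ < 1) : tailSeries i z =
    tailSeries (i + 1) z - fracCoeff (i + 1) • (z * tailSeries (i + 2) z) := by
  unfold tailSeries
  have s := fun i => summable_tailCoeff i hz
  have s' := fun i => (summable_nat_add_iff 1).2 (s i)
  rw [(s i).tsum_eq_zero_add, (s (i + 1)).tsum_eq_zero_add, ← tsum_mul_left,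
    ← ((s (i + 2)).mul_left z).tsum_const_smul, add_sub_assoc,
    ← (s' (i + 1)).tsum_sub (((s (i + 2)).mul_left z).const_smul _)]
  congr 1
  refine tsum_congr fun j => ?_
  rw [tailCoeff_succ i j, sub_smul, mul_smul_comm, smul_smul, pow_succ' z j]

lemma norm_tailSeries_le (i : ℕ) {z : 𝕜} {x : ℝ} (hzx : ‖z‖ ≤ x) (hx : x < 1) :
    ‖tailSeries i z‖ ≤ tailSeries i x := by
  have hx0 : 0 ≤ x := (norm_nonneg z).trans hzx
  refine tsum_of_norm_bounded
    (summable_tailCoeff i (z := x) (by rwa [Real.norm_of_nonneg hx0])).hasSum fun j => ?_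
  rw [norm_smul, norm_pow, Real.norm_of_nonneg (tailCoeff_nonneg i j), smul_eq_mul]
  gcongr
  exact tailCoeff_nonneg i j

/-! ### Convergence of the continued fraction -/

/-- Denominators of the convergents of `1 / (1 - n₁ z / (1 - n₂ z / ⋯))`. -/
def fracDen (z : 𝕜) : ℕ → 𝕜
  | 0 => 1
  | 1 => 1
  | N + 2 => fracDen z (N + 1) - fracCoeff (N + 1) • (z * fracDen z N)

/-- Numerators of the convergents of `1 / (1 - n₁ z / (1 - n₂ z / ⋯))`. -/
def fracNum (z : 𝕜) : ℕ → 𝕜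
  | 0 => 0
  | 1 => 1
  | N + 2 => fracNum z (N + 1) - fracCoeff (N + 1) • (z * fracNum z N)

/-- The linear form `F₁ B_N - A_N` is the minimal solution of the three-term recurrence. -/
lemma tailSeries_one_mul_fracDen_sub_fracNum {z : 𝕜} (hz : ‖z‖ < 1) (N : ℕ) :
    tailSeries 1 z * fracDen z N - fracNum z N =
      (∏ m ∈ Finset.range N, fracCoeff (m + 1)) • (z ^ N * tailSeries (N + 1) z) := by
  induction N using Nat.twoStepInduction with
  | zero => simp [fracDen, fracNum]
  | one =>
    have := tailSeries_eq 0 hz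
    rw [tailSeries_zero_left] at this
    simp only [fracDen, fracNum, Finset.prod_range_one]
    simp only [zero_add] at this ⊢
    rw [pow_one, mul_one]
    linear_combination -this
  | more N ih1 ih2 =>
    have h := tailSeries_eq (N + 1) hz
    rw [fracDen, fracNum]
    simp only [Finset.prod_range_succ, RCLike.real_smul_eq_coe_mul, RCLike.ofReal_mul]
      at ih1 ih2 h ⊢
    linear_combination ih2 - (fracCoeff (N + 1) : 𝕜) * z * ih1 -
      ((∏ m ∈ Finset.range N, fracCoeff (m + 1) : ℝ) : 𝕜) * (fracCoeff (N + 1) : 𝕜) *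
        z ^ (N + 1) * h

/-- The parameters `g_{2k} = k / (2k + 1/3)`, `g_{2k+1} = 1/2` exhibiting the coefficients as a
chain sequence `n_m = (1 - g_{m-1}) g_m`. -/
def chainParam (m : ℕ) : ℝ :=
  if Even m then ((m / 2 : ℕ) : ℝ) / (2 * ((m / 2 : ℕ) : ℝ) + 1 / 3) else 1 / 2

lemma chainParam_nonneg (m : ℕ) : 0 ≤ chainParam m := by
  unfold chainParam
  split_ifs <;> positivity

lemma chainParam_lt_one (m : ℕ) : chainParam m < 1 := by
  unfold chainParam
  split_ifs
  · rw [div_lt_one (by positivity)]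
    have : (0 : ℝ) ≤ (m / 2 : ℕ) := by positivity
    linarith
  · norm_num

lemma fracCoeff_succ_eq_chain (m : ℕ) :
    fracCoeff (m + 1) = (1 - chainParam m) * chainParam (m + 1) := by
  rcases Nat.even_or_odd' m with ⟨k, rfl | rfl⟩
  · have e1 : 2 * k / 2 = k := by omega
    have e2 : (2 * k + 1) / 2 = k := by omega
    have e6 : ¬ Even (2 * k + 1) := by simp
    simp only [fracCoeff, chainParam, e1, e2, e6, if_false, even_two_mul, if_true]
    field_simp
    ring
  · have e2 : (2 * k + 1 + 1) / 2 = k + 1 := by omega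
    have e5 : ¬ Even (2 * k + 1) := by simp
    have e6 : Even (2 * k + 1 + 1) := ⟨k + 1, by ring⟩
    simp only [fracCoeff, chainParam, e2, e5, e6, if_false, if_true]
    push_cast
    field_simp
    ring

/-- Positive solutions of the three-term recurrence at `x ∈ [0, 1]` stay positive. -/
lemma pos_of_recurrence {x : ℝ} (hx0 : 0 ≤ x) (hx1 : x ≤ 1) {u : ℕ → ℝ}
    (h01 : u 0 ≤ u 1) (h1 : 0 < u 1)
    (hu : ∀ N, u (N + 2) = u (N + 1) - fracCoeff (N + 1) • (x * u N)) (N : ℕ) :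
    (1 - chainParam N) * u N ≤ u (N + 1) ∧ 0 < u (N + 1) := by
  induction N with
  | zero => simpa [chainParam] using ⟨h01, h1⟩
  | succ N ih =>
    have hg := chainParam_nonneg (N + 1)
    have hg1 := chainParam_lt_one (N + 1)
    have key : (1 - chainParam (N + 1)) * u (N + 1) ≤ u (N + 2) := by
      rw [hu, fracCoeff_succ_eq_chain, smul_eq_mul]
      have h2 : chainParam (N + 1) * x * ((1 - chainParam N) * u N) ≤
          chainParam (N + 1) * x * u (N + 1) := by gcongr; exact ih.1
      have h3 : chainParam (N + 1) * x * u (N + 1) ≤ chainParam (N + 1) * 1 * u (N + 1) := by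
        gcongr
        exact ih.2.le
      linarith
    exact ⟨key, lt_of_lt_of_le (mul_pos (by linarith) ih.2) key⟩

lemma fracDen_pos {x : ℝ} (hx0 : 0 ≤ x) (hx1 : x ≤ 1) (N : ℕ) : 0 < fracDen x N := by
  cases N with
  | zero => simp [fracDen]
  | succ N =>
    exact (pos_of_recurrence hx0 hx1 (u := fracDen x) (by simp [fracDen])
      (by simp [fracDen]) (fun _ => rfl) N).2

lemma fracNum_nonneg {x : ℝ} (hx0 : 0 ≤ x) (hx1 : x ≤ 1) (N : ℕ) : 0 ≤ fracNum x N := by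
  cases N with
  | zero => simp [fracNum]
  | succ N =>
    exact (pos_of_recurrence hx0 hx1 (u := fracNum x) (by simp [fracNum])
      (by simp [fracNum]) (fun _ => rfl) N).2.le

/-- On the disc `‖z‖ ≤ x` the denominators are smallest at `z = x`. The induction compares the
ratios of consecutive denominators. -/
lemma fracDen_le_norm {z : 𝕜} {x : ℝ} (hzx : ‖z‖ ≤ x) (hx1 : x ≤ 1) (N : ℕ) :
    fracDen x N ≤ ‖fracDen z N‖ := by
  have hx0 : 0 ≤ x := (norm_nonneg z).trans hzx
  have hpos := fracDen_pos hx0 hx1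
  have ratio : ∀ N, fracDen x (N + 1) * ‖fracDen z N‖ ≤ ‖fracDen z (N + 1)‖ * fracDen x N := by
    intro N
    induction N with
    | zero => simp [fracDen]
    | succ N ih =>
      have h1 : ‖fracDen z (N + 1)‖ - fracCoeff (N + 1) * (x * ‖fracDen z N‖) ≤
          ‖fracDen z (N + 2)‖ := by
        rw [fracDen]
        refine le_trans ?_ (norm_sub_norm_le _ _)
        rw [norm_smul, norm_mul, Real.norm_of_nonneg (fracCoeff_nonneg _)]
        have := fracCoeff_nonneg (N + 1)
        gcongr
      have h2 := mul_le_mul_of_nonneg_right h1 (hpos (N + 1)).le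
      have h3 := mul_le_mul_of_nonneg_left ih (mul_nonneg (fracCoeff_nonneg (N + 1)) hx0)
      rw [show fracDen x (N + 1 + 1) = fracDen x (N + 1) - fracCoeff (N + 1) • (x * fracDen x N)
        from rfl, smul_eq_mul]
      change _ ≤ ‖fracDen z (N + 2)‖ * _
      linarith
  induction N with
  | zero => simp [fracDen]
  | succ N ih =>
    have h1 : fracDen x (N + 1) * fracDen x N ≤ ‖fracDen z (N + 1)‖ * fracDen x N :=
      (mul_le_mul_of_nonneg_left ih (hpos _).le).trans (ratio N)
    exact le_of_mul_le_mul_right h1 (hpos N)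

/-- The error of the `N`-th convergent at `z` is at most `(‖z‖ / x) ^ N` times `F₁(x)`. The
positivity of the numerators bounds the error at `x` by `F₁(x)`; the power of `‖z‖ / x` is the
order of vanishing of the error at the origin. -/
lemma norm_tailSeries_sub_div_le {z : 𝕜} {x : ℝ} (hzx : ‖z‖ ≤ x) (hx0 : 0 < x) (hx : x < 1)
    (N : ℕ) :
    ‖fracNum z N / fracDen z N - tailSeries 1 z‖ ≤ (‖z‖ / x) ^ N * tailSeries 1 x := by
  have hz : ‖z‖ < 1 := hzx.trans_lt hx
  have hpos := fracDen_pos hx0.le hx.le N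
  have hle := fracDen_le_norm hzx hx.le N
  have hne : fracDen z N ≠ 0 := norm_pos_iff.1 (hpos.trans_le hle)
  have hP : 0 ≤ ∏ m ∈ Finset.range N, fracCoeff (m + 1) :=
    Finset.prod_nonneg fun _ _ => fracCoeff_nonneg _
  have hE := tailSeries_one_mul_fracDen_sub_fracNum hz N
  have hEx := tailSeries_one_mul_fracDen_sub_fracNum (z := x)
    (by rwa [Real.norm_of_nonneg hx0.le]) N
  have hnum := fracNum_nonneg hx0.le hx.le N
  have hxE : (∏ m ∈ Finset.range N, fracCoeff (m + 1)) * (x ^ N * tailSeries (N + 1) x) ≤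
      tailSeries 1 x * fracDen x N := by
    rw [smul_eq_mul] at hEx
    linarith
  have h1 : fracNum z N / fracDen z N - tailSeries 1 z =
      -(tailSeries 1 z * fracDen z N - fracNum z N) / fracDen z N := by
    field_simp
    ring
  have hS1 : 0 ≤ tailSeries 1 x := (norm_nonneg _).trans (norm_tailSeries_le 1 hzx hx)
  rw [h1, hE, norm_div, norm_neg, norm_smul, norm_mul, norm_pow, Real.norm_of_nonneg hP,
    div_le_iff₀ (norm_pos_iff.2 hne)]
  calc (∏ m ∈ Finset.range N, fracCoeff (m + 1)) * (‖z‖ ^ N * ‖tailSeries (N + 1) z‖)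
      ≤ (∏ m ∈ Finset.range N, fracCoeff (m + 1)) * (‖z‖ ^ N * tailSeries (N + 1) x) := by
        gcongr
        exact norm_tailSeries_le _ hzx hx
    _ = (‖z‖ / x) ^ N *
        ((∏ m ∈ Finset.range N, fracCoeff (m + 1)) * (x ^ N * tailSeries (N + 1) x)) := by
        rw [div_pow]
        field_simp
    _ ≤ (‖z‖ / x) ^ N * (tailSeries 1 x * fracDen x N) := by gcongr
    _ ≤ (‖z‖ / x) ^ N * (tailSeries 1 x * ‖fracDen z N‖) := by gcongr
    _ = _ := by ring

lemma gaussFraction_get? (z : ℂ) (m : ℕ) :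
    (gaussFraction z).s.get? m = some ⟨if m = 0 then 1 else -(coeff m * z), 1⟩ := rfl

lemma gaussFraction_nums (z : ℂ) (N : ℕ) : (gaussFraction z).nums N = fracNum z N := by
  induction N using Nat.twoStepInduction with
  | zero => simp [fracNum, gaussFraction]
  | one => simpa [fracNum, gaussFraction] using
      GenContFract.first_num_eq (gaussFraction_get? z 0)
  | more N ih1 ih2 =>
    rw [GenContFract.nums_recurrence (gaussFraction_get? z (N + 1)) ih1 ih2, fracNum,
      if_neg (by omega), ← ofReal_fracCoeff, Complex.real_smul]
    ring

lemma gaussFraction_dens (z : ℂ) (N : ℕ) : (gaussFraction z).dens N = fracDen z N := by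
  induction N using Nat.twoStepInduction with
  | zero => simp [fracDen]
  | one => simpa [fracDen] using GenContFract.first_den_eq (gaussFraction_get? z 0)
  | more N ih1 ih2 =>
    rw [GenContFract.dens_recurrence (gaussFraction_get? z (N + 1)) ih1 ih2, fracDen,
      if_neg (by omega), ← ofReal_fracCoeff, Complex.real_smul]
    ring

/-- Gauss's continued fraction converges on the open unit disc to `₂F₁(2/3, 1; 4/3; z)`. -/
theorem gaussFraction_convergesTo {z : ℂ} (hz : ‖z‖ < 1) :
    ConvergesTo (gaussFraction z) (tailSeries 1 z) := by
  obtain ⟨x, hzx, hx1⟩ := exists_between hz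
  have hx0 : 0 < x := (norm_nonneg z).trans_lt hzx
  refine ⟨Eventually.of_forall fun N => ?_, ?_⟩
  · rw [gaussFraction_dens]
    exact norm_pos_iff.1 ((fracDen_pos hx0.le hx1.le N).trans_le (fracDen_le_norm hzx.le hx1.le N))
  · rw [tendsto_iff_norm_sub_tendsto_zero]
    have hlim : Tendsto (fun N : ℕ => (‖z‖ / x) ^ N * tailSeries 1 x) atTop (𝓝 0) := by
      simpa using (tendsto_pow_atTop_nhds_zero_of_lt_one (by positivity)
        ((div_lt_one hx0).2 hzx)).mul_const (tailSeries 1 x)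
    refine squeeze_zero (fun _ => norm_nonneg _) (fun N => ?_) hlim
    rw [GenContFract.conv_eq_num_div_den, gaussFraction_nums, gaussFraction_dens]
    exact norm_tailSeries_sub_div_le hzx.le hx0 hx1 N

/-! ### The differential equation of the hypergeometric series -/

lemma tailCoeff_one_succ (j : ℕ) :
    tailCoeff 1 (j + 1) = tailCoeff 1 j * ((2 / 3 + j) / (4 / 3 + j)) := by
  simp only [tailCoeff, gaussCoeff]
  norm_num
  left
  field_simp

lemma tailCoeff_one_le_one (j : ℕ) : tailCoeff 1 j ≤ 1 := by
  induction j with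
  | zero => simp [tailCoeff_zero]
  | succ j ih =>
    rw [tailCoeff_one_succ]
    refine mul_le_one₀ ih (by positivity) ((div_le_one (by positivity)).2 (by linarith))

/-- The first-order equation for `F = ₂F₁(2/3, 1; 4/3; z)`; it says that
`(z (1 - z)) ^ (1/3) * F` has derivative `(z (1 - z)) ^ (-2/3) / 3`. -/
lemma exists_hasDerivAt_tailSeries_one {z : ℂ} (hz : ‖z‖ < 1) :
    ∃ d : ℂ, HasDerivAt (tailSeries (𝕜 := ℂ) 1) d z ∧
      (1 - 2 * z) * tailSeries 1 z + 3 * (z * (1 - z)) * d = 1 := by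
  obtain ⟨ρ, hzρ, hρ1⟩ := exists_between hz
  have hρ0 : 0 ≤ ρ := (norm_nonneg z).trans hzρ.le
  have hbd : ∀ (j : ℕ), ∀ y ∈ Metric.ball (0 : ℂ) ρ,
      ‖tailCoeff 1 j • ((j : ℂ) * y ^ (j - 1))‖ ≤ j * ρ ^ (j - 1) := by
    intro j y hy
    rw [norm_smul, Real.norm_of_nonneg (tailCoeff_nonneg _ _), norm_mul, norm_pow,
      Complex.norm_natCast]
    have hy' : ‖y‖ ≤ ρ := by simpa using (Metric.mem_ball.1 hy).le
    calc _ ≤ 1 * ((j : ℝ) * ρ ^ (j - 1)) := by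
          gcongr
          exact tailCoeff_one_le_one j
      _ = _ := one_mul _
  have hu : Summable fun j : ℕ => (j : ℝ) * ρ ^ (j - 1) := by
    rw [← summable_nat_add_iff 1]
    have h1 := summable_pow_mul_geometric_of_norm_lt_one 1 (r := ρ)
      (by rwa [Real.norm_of_nonneg hρ0])
    have h2 := summable_geometric_of_lt_one hρ0 hρ1
    refine (h1.add h2).congr fun j => ?_
    push_cast
    simp
    ring
  have hmem : z ∈ Metric.ball (0 : ℂ) ρ := by simpa using hzρ
  have hder := hasDerivAt_tsum_of_isPreconnected (g := fun j y => tailCoeff 1 j • y ^ j)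
    (g' := fun j y => tailCoeff 1 j • ((j : ℂ) * y ^ (j - 1))) hu Metric.isOpen_ball
    (convex_ball (0 : ℂ) ρ).isPreconnected
    (fun j y _ => (hasDerivAt_pow j y).const_smul (tailCoeff 1 j)) hbd hmem
    (summable_tailCoeff 1 hz) hmem
  refine ⟨_, hder, ?_⟩
  have hs := summable_tailCoeff 1 hz
  have hs' : Summable fun j => tailCoeff 1 j • ((j : ℂ) * z ^ (j - 1)) :=
    Summable.of_norm_bounded hu fun j => hbd j z hmem
  have e1 : tailSeries 1 z = 1 + ∑' j, tailCoeff 1 (j + 1) • z ^ (j + 1) := by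
    rw [tailSeries, hs.tsum_eq_zero_add]
    simp [tailCoeff_zero]
  have e2 : ∑' j, tailCoeff 1 j • ((j : ℂ) * z ^ (j - 1)) =
      ∑' j, tailCoeff 1 (j + 1) • (((j + 1 : ℕ) : ℂ) * z ^ j) := by
    rw [hs'.tsum_eq_zero_add]
    simp
  have s1 := (summable_nat_add_iff 1).2 hs
  have s2 := (summable_nat_add_iff 1).2 hs'
  have hsum : (∑' j, tailCoeff 1 (j + 1) • z ^ (j + 1)) - 2 * z * tailSeries 1 z +
      3 * (z * ∑' j, tailCoeff 1 (j + 1) • (((j + 1 : ℕ) : ℂ) * z ^ j)) -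
      3 * (z ^ 2 * ∑' j, tailCoeff 1 j • ((j : ℂ) * z ^ (j - 1))) = 0 := by
    have s2' : Summable fun j => tailCoeff 1 (j + 1) • (((j + 1 : ℕ) : ℂ) * z ^ j) := s2
    rw [tailSeries, ← tsum_mul_left, ← tsum_mul_left, ← tsum_mul_left, ← tsum_mul_left,
      ← tsum_mul_left, ← s1.tsum_sub (hs.mul_left _),
      ← (s1.sub (hs.mul_left _)).tsum_add ((s2'.mul_left _).mul_left _),
      ← ((s1.sub (hs.mul_left _)).add ((s2'.mul_left _).mul_left _)).tsum_sub
        ((hs'.mul_left _).mul_left _)]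
    refine (tsum_congr fun j => ?_).trans tsum_zero
    -- At `j = 0` the exponent `j - 1` is truncated to `0`, but the factor `j` vanishes.
    have hz2 : z ^ 2 * ((j : ℂ) * z ^ (j - 1)) = j * z ^ (j + 1) := by
      cases j with
      | zero => simp
      | succ j => rw [Nat.add_sub_cancel]; ring
    have ht : (tailCoeff 1 (j + 1) : ℂ) * (4 / 3 + j) = tailCoeff 1 j * (2 / 3 + j) := by
      have : tailCoeff 1 (j + 1) * (4 / 3 + j) = tailCoeff 1 j * (2 / 3 + j) := by
        rw [tailCoeff_one_succ]
        field_simp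
      simpa using congrArg Complex.ofReal this
    rw [mul_smul_comm (tailCoeff 1 j) (z ^ 2), hz2]
    simp only [Complex.real_smul]
    push_cast
    linear_combination 3 * z ^ (j + 1) * ht
  rw [← e2] at hsum
  linear_combination hsum + e1

/-! ### Holomorphic functions invariant under the modular group -/

/-- The filter of neighbourhoods of the cusp `i∞`. -/
abbrev imInfty : Filter ℂ := comap Complex.im atTop

lemma eventually_imInfty_im_gt (Y : ℝ) : ∀ᶠ τ in imInfty, Y < τ.im :=
  tendsto_comap.eventually (eventually_gt_atTop Y)

lemma im_neg_one_div_pos {τ : ℂ} (hτ : 0 < τ.im) : 0 < (-1 / τ).im := by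
  rw [neg_div, neg_im, one_div, inv_im, neg_div, neg_neg]
  exact div_pos hτ (normSq_pos.2 (by rintro rfl; simp at hτ))

lemma isOpen_im_pos : IsOpen {τ : ℂ | 0 < τ.im} := isOpen_lt continuous_const continuous_im

open UpperHalfPlane MatrixGroups ModularForm in
/-- A holomorphic function on the upper half-plane, invariant under `τ ↦ τ + 1` and `τ ↦ -1/τ`,
with a limit at `i∞`, is constant: it is a modular form of level one and weight zero. -/
theorem eq_of_modular_invariant {f : ℂ → ℂ} {c : ℂ}
    (hd : DifferentiableOn ℂ f {τ | 0 < τ.im})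
    (hT : ∀ τ : ℂ, 0 < τ.im → f (τ + 1) = f τ)
    (hS : ∀ τ : ℂ, 0 < τ.im → f (-1 / τ) = f τ)
    (hlim : Tendsto f imInfty (𝓝 c)) {τ : ℂ} (hτ : 0 < τ.im) : f τ = c := by
  have hsl : ∀ γ : SL(2, ℤ), (fun z : ℍ => f z) ∣[(0 : ℤ)] γ = fun z : ℍ => f z := by
    refine SlashInvariantForm.slash_action_generators_SL2Z ?_ ?_
    · ext z
      rw [ModularForm.SL_slash_apply, modular_S_smul]
      simpa [neg_div] using hS z z.2
    · ext z
      rw [ModularForm.SL_slash_apply, modular_T_smul]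
      simpa [add_comm] using hT z z.2
  have hlim' : Tendsto (fun z : ℍ => f z) atImInfty (𝓝 c) := hlim.comp tendsto_coe_atImInfty
  let F : ModularForm 𝒮ℒ 0 :=
    { toFun := fun z => f z
      slash_action_eq' := fun _ ⟨γ, hγ⟩ => hγ ▸ hsl γ
      holo' := by
        rw [UpperHalfPlane.mdifferentiable_iff]
        refine hd.congr fun z hz => ?_
        simp [ofComplex_apply_of_im_pos hz]
      bdd_at_cusps' := fun {c'} hc => by
        rw [Subgroup.IsArithmetic.isCusp_iff_isCusp_SL2Z] at hc
        rw [OnePoint.isBoundedAt_iff_forall_SL2Z hc]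
        intro γ _
        rw [hsl γ]
        exact hlim'.isBigO_one ℝ }
  obtain ⟨c', hc'⟩ := ModularFormClass.levelOne_weight_zero_const F
  have hval : ∀ z : ℍ, f z = c' := fun z => congrFun hc' z
  have hcc : c' = c := by
    refine tendsto_nhds_unique ?_ hlim'
    exact tendsto_const_nhds.congr fun z => (hval z).symm
  rw [← hcc]
  exact hval ⟨τ, hτ⟩

/-- By Cauchy's estimate, a holomorphic function with a limit at `i∞` has derivative tending to
zero there. -/
lemma tendsto_deriv_imInfty {f : ℂ → ℂ} {c : ℂ} (hd : DifferentiableOn ℂ f {τ | 0 < τ.im})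
    (hlim : Tendsto f imInfty (𝓝 c)) : Tendsto (deriv f) imInfty (𝓝 0) := by
  rw [Metric.tendsto_nhds]
  intro ε hε
  have h1 := (Metric.tendsto_nhds.1 hlim) (ε / 2) (by positivity)
  rw [eventually_comap, eventually_atTop] at h1
  obtain ⟨Y, hY⟩ := h1
  filter_upwards [eventually_imInfty_im_gt (max Y 0 + 1)] with τ hτ
  have him : ∀ w ∈ Metric.closedBall τ 1, max Y 0 < w.im := by
    intro w hw
    have h2 := (abs_im_le_norm (w - τ)).trans (by simpa [dist_eq_norm] using hw)
    rw [sub_im, abs_le] at h2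
    linarith [h2.1]
  have hdc : DiffContOnCl ℂ (fun w => f w - c) (Metric.ball τ 1) := by
    refine DifferentiableOn.diffContOnCl ?_
    rw [closure_ball τ one_ne_zero]
    exact (hd.mono fun w hw => (le_max_right _ _).trans_lt (him w hw)).sub_const c
  have hC : ∀ w ∈ Metric.sphere τ 1, ‖f w - c‖ ≤ ε / 2 := by
    intro w hw
    rw [← dist_eq_norm]
    exact (hY w.im ((le_max_left _ _).trans (him w (Metric.sphere_subset_closedBall hw)).le)
      w rfl).le
  have h3 := norm_deriv_le_of_forall_mem_sphere_norm_le one_pos hdc hC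
  rw [deriv_sub_const, div_one] at h3
  rw [dist_zero_right]
  linarith

/-! ### Transformation laws of the theta constants and of the eta function -/

/-- The theta constant `θ₄(τ) = ∑_{n ∈ ℤ} (-1)ⁿ exp(π i n² τ)`, encoded as `θ₃(τ + 1)`. -/
def theta4 (τ : ℂ) : ℂ := jacobiTheta (τ + 1)

lemma exp_pi_mul_I_mul_of_even {n : ℤ} (hn : Even n) : cexp (Real.pi * I * n) = 1 := by
  obtain ⟨m, rfl⟩ := hn
  rw [Complex.exp_eq_one_iff]
  exact ⟨m, by push_cast; ring⟩

lemma theta4_eq (τ : ℂ) : theta4 τ = jacobiTheta₂ (1 / 2) τ := by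
  unfold theta4 jacobiTheta jacobiTheta₂
  refine tsum_congr fun n => ?_
  rw [jacobiTheta₂_term]
  have h := exp_pi_mul_I_mul_of_even (n := n * (n - 1)) (Int.even_mul_pred_self n)
  rw [show (Real.pi * I * (n : ℂ) ^ 2 * (τ + 1) : ℂ) =
      (2 * Real.pi * I * n * (1 / 2) + Real.pi * I * n ^ 2 * τ) +
        Real.pi * I * ((n * (n - 1) : ℤ) : ℂ) by push_cast; ring, Complex.exp_add, h, mul_one]

lemma theta3_add_one (τ : ℂ) : theta3 (τ + 1) = theta4 τ := rfl

lemma theta4_add_one (τ : ℂ) : theta4 (τ + 1) = theta3 τ := by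
  rw [theta4, theta3, ← jacobiTheta_two_add τ]
  ring_nf

/-- The factor `∑ exp(π i (n² + n) τ)` of `θ₂(τ)`, a power series in `exp(2π i τ)`. -/
def theta2Series (τ : ℂ) : ℂ := jacobiTheta₂ (τ / 2) τ

lemma theta2Series_eq_tsum (τ : ℂ) :
    theta2Series τ = ∑' n : ℤ, cexp (Real.pi * I * ((n * (n + 1) : ℤ) : ℂ) * τ) := by
  unfold theta2Series jacobiTheta₂
  refine tsum_congr fun n => ?_
  rw [jacobiTheta₂_term]
  congr 1
  push_cast
  ring

lemma theta2Series_add_one (τ : ℂ) : theta2Series (τ + 1) = theta2Series τ := by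
  simp only [theta2Series_eq_tsum]
  refine tsum_congr fun n => ?_
  rw [mul_add, mul_one, Complex.exp_add, exp_pi_mul_I_mul_of_even (Int.even_mul_succ_self n),
    mul_one]

lemma theta2_pow_four (τ : ℂ) :
    theta2 τ ^ 4 = cexp (Real.pi * I * τ) * theta2Series τ ^ 4 := by
  rw [theta2, mul_pow, ← Complex.exp_nat_mul, theta2Series]
  congr 2
  push_cast
  ring

lemma exp_pi_I_mul_add_one (τ : ℂ) :
    cexp (Real.pi * I * (τ + 1)) = -cexp (Real.pi * I * τ) := by
  rw [mul_add, mul_one, Complex.exp_add, Complex.exp_pi_mul_I, mul_neg_one]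

lemma theta2_add_one_pow_four (τ : ℂ) : theta2 (τ + 1) ^ 4 = -theta2 τ ^ 4 := by
  rw [theta2_pow_four, theta2_pow_four, theta2Series_add_one, exp_pi_I_mul_add_one, neg_mul]

lemma cpow_half_pow_four {τ : ℂ} : ((-I * τ) ^ (1 / 2 : ℂ)) ^ 4 = -τ ^ 2 := by
  rw [← Complex.cpow_nat_mul, show ((4 : ℕ) : ℂ) * (1 / 2) = (2 : ℕ) by norm_num,
    Complex.cpow_natCast]
  ring_nf
  simp

lemma theta3_S_pow_four {τ : ℂ} (hτ : 0 < τ.im) :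
    theta3 (-1 / τ) ^ 4 = -τ ^ 2 * theta3 τ ^ 4 := by
  have h := jacobiTheta_S_smul ⟨τ, hτ⟩
  rw [UpperHalfPlane.modular_S_smul] at h
  have h' : theta3 (-1 / τ) = (-I * τ) ^ (1 / 2 : ℂ) * theta3 τ := by
    simpa [theta3, neg_div, inv_neg] using h
  rw [h', mul_pow, cpow_half_pow_four]

lemma theta2_S_pow_four {τ : ℂ} (hτ : 0 < τ.im) :
    theta2 (-1 / τ) ^ 4 = -τ ^ 2 * theta4 τ ^ 4 := by
  have hτ0 : τ ≠ 0 := by rintro rfl; simp at hτ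
  have hs : (-I * τ) ^ (1 / 2 : ℂ) ≠ 0 := by
    rw [Ne, cpow_eq_zero_iff, not_and_or]
    exact Or.inl (mul_ne_zero (neg_ne_zero.mpr I_ne_zero) hτ0)
  have h := jacobiTheta₂_functional_equation (1 / 2) τ
  rw [← theta4_eq] at h
  have h' : theta2 (-1 / τ) = (-I * τ) ^ (1 / 2 : ℂ) * theta4 τ := by
    rw [h, theta2, ← jacobiTheta₂_neg_left]
    rw [show (-(-1 / τ / 2) : ℂ) = 1 / 2 / τ by field_simp,
      show (Real.pi * I * (-1 / τ) / 4 : ℂ) = -Real.pi * I * (1 / 2) ^ 2 / τ by field_simp; ring]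
    field_simp
  rw [h', mul_pow, cpow_half_pow_four]

lemma theta4_S_pow_four {τ : ℂ} (hτ : 0 < τ.im) :
    theta4 (-1 / τ) ^ 4 = -τ ^ 2 * theta2 τ ^ 4 := by
  have hτ0 : τ ≠ 0 := by rintro rfl; simp at hτ
  have h := theta2_S_pow_four (im_neg_one_div_pos hτ)
  rw [show (-1 / (-1 / τ) : ℂ) = τ by field_simp] at h
  rw [h]
  field_simp

/-- The product `∏ (1 - qⁿ)` in the eta function. -/
def eulerProd (τ : ℂ) : ℂ := ∏' n, (1 - ModularForm.eta_q n τ)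

lemma eta_eq (τ : ℂ) : ModularForm.eta τ = Function.Periodic.qParam 24 τ * eulerProd τ := rfl

lemma eta_pow_four (τ : ℂ) :
    ModularForm.eta τ ^ 4 = cexp (Real.pi * I * τ / 3) * eulerProd τ ^ 4 := by
  rw [eta_eq, mul_pow, Function.Periodic.qParam, ← Complex.exp_nat_mul]
  congr 2
  push_cast
  ring

lemma eta_pow_twelve (τ : ℂ) :
    ModularForm.eta τ ^ 12 = cexp (Real.pi * I * τ) * eulerProd τ ^ 12 := by
  rw [eta_eq, mul_pow, Function.Periodic.qParam, ← Complex.exp_nat_mul]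
  congr 2
  push_cast
  ring

lemma eulerProd_add_one (τ : ℂ) : eulerProd (τ + 1) = eulerProd τ := by
  unfold eulerProd
  have : Function.Periodic.qParam 1 (τ + 1) = Function.Periodic.qParam 1 τ := by
    simp [Function.Periodic.qParam, mul_add, Complex.exp_add, Complex.exp_two_pi_mul_I]
  simp only [ModularForm.eta_q, this]

lemma eta_add_one_pow_twelve (τ : ℂ) :
    ModularForm.eta (τ + 1) ^ 12 = -ModularForm.eta τ ^ 12 := by
  rw [eta_pow_twelve, eta_pow_twelve, eulerProd_add_one, exp_pi_I_mul_add_one, neg_mul]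

lemma sqrt_pow_twelve (z : ℂ) : Complex.sqrt z ^ 12 = z ^ 6 := by
  rw [Complex.sqrt, ← Complex.cpow_nat_mul,
    show ((12 : ℕ) : ℂ) * 2⁻¹ = (6 : ℕ) by norm_num, Complex.cpow_natCast]

lemma eta_S_pow_twelve {τ : ℂ} (hτ : 0 < τ.im) :
    ModularForm.eta (-1 / τ) ^ 12 = -τ ^ 6 * ModularForm.eta τ ^ 12 := by
  have h : ModularForm.eta (-1 / τ) =
      (Complex.sqrt I)⁻¹ * (Complex.sqrt τ * ModularForm.eta τ) := by
    simpa using ModularForm.eta_comp_eq_csqrt_I_inv (x := τ) hτ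
  have hI : (I : ℂ) ^ 6 = -1 := by
    rw [show (6 : ℕ) = 2 * 3 from rfl, pow_mul, I_sq]; norm_num
  rw [h, mul_pow, mul_pow, inv_pow, sqrt_pow_twelve, sqrt_pow_twelve, hI]
  norm_num

/-! ### Behaviour at the cusp -/

lemma tendsto_exp_imInfty {a : ℝ} (ha : 0 < a) :
    Tendsto (fun τ : ℂ => cexp (a * I * τ)) imInfty (𝓝 0) := by
  rw [tendsto_zero_iff_norm_tendsto_zero]
  have h1 : Tendsto (fun τ : ℂ => Real.exp (-(a * τ.im))) imInfty (𝓝 0) :=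
    Real.tendsto_exp_neg_atTop_nhds_zero.comp
      ((tendsto_comap (f := Complex.im)).const_mul_atTop ha)
  refine h1.congr fun τ => ?_
  rw [Complex.norm_exp]
  simp

lemma norm_exp_pi_I_mul (τ : ℂ) : ‖cexp (Real.pi * I * τ)‖ = Real.exp (-Real.pi * τ.im) := by
  rw [Complex.norm_exp]
  simp

lemma theta3_sub_one_isBigO :
    (fun τ => theta3 τ - 1) =O[imInfty] fun τ => cexp (Real.pi * I * τ) := by
  refine isBigO_at_im_infty_jacobiTheta_sub_one.trans_le fun τ => ?_
  rw [norm_exp_pi_I_mul, Real.norm_of_nonneg (Real.exp_pos _).le]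

lemma tendsto_add_one_imInfty : Tendsto (fun τ : ℂ => τ + 1) imInfty imInfty := by
  rw [tendsto_comap_iff]
  refine tendsto_comap.congr fun τ => ?_
  simp

lemma theta4_sub_one_isBigO :
    (fun τ => theta4 τ - 1) =O[imInfty] fun τ => cexp (Real.pi * I * τ) := by
  refine (theta3_sub_one_isBigO.comp_tendsto tendsto_add_one_imInfty).trans_le fun τ => ?_
  simp only [Function.comp]
  rw [exp_pi_I_mul_add_one, norm_neg]

lemma tendsto_theta3_imInfty : Tendsto theta3 imInfty (𝓝 1) := by
  have := theta3_sub_one_isBigO.trans_tendsto (tendsto_exp_imInfty Real.pi_pos)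
  simpa using this.add_const 1

lemma tendsto_theta4_imInfty : Tendsto theta4 imInfty (𝓝 1) :=
  tendsto_theta3_imInfty.comp tendsto_add_one_imInfty

lemma tendsto_theta2Series_imInfty : Tendsto theta2Series imInfty (𝓝 2) := by
  have hsum : Summable fun n : ℤ => ‖jacobiTheta₂_term n (I / 2) I‖ :=
    ((summable_jacobiTheta₂_term_iff (I / 2) I).2 (by simp)).norm
  have hnn : ∀ n : ℤ, 0 ≤ n * (n + 1) := by
    intro n
    rcases le_or_gt 0 n with h | h
    · positivity
    · nlinarith
  have key := tendsto_tsum_of_dominated_convergence (𝓕 := imInfty)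
    (f := fun (τ : ℂ) (n : ℤ) => cexp (Real.pi * I * ((n * (n + 1) : ℤ) : ℂ) * τ))
    (g := fun n : ℤ => if n ∈ ({0, -1} : Finset ℤ) then 1 else 0) hsum ?_ ?_
  · have e : ∑' n : ℤ, (if n ∈ ({0, -1} : Finset ℤ) then (1 : ℂ) else 0) = 2 := by
      rw [tsum_eq_sum (s := ({0, -1} : Finset ℤ)) fun b hb => if_neg hb,
        Finset.sum_congr rfl fun b hb => if_pos hb]
      norm_num
    rw [e] at key
    exact key.congr fun τ => (theta2Series_eq_tsum τ).symm
  · intro n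
    by_cases hn : n ∈ ({0, -1} : Finset ℤ)
    · rw [if_pos hn]
      have h0 : n * (n + 1) = 0 := by
        rcases (by simpa using hn : n = 0 ∨ n = -1) with rfl | rfl <;> rfl
      simpa [h0] using tendsto_const_nhds
    · rw [if_neg hn]
      have h0 : 0 < n * (n + 1) := by
        refine lt_of_le_of_ne (hnn n) fun h => hn ?_
        rcases mul_eq_zero.1 h.symm with h | h
        · simp [h]
        · simp [show n = -1 by omega]
      have h1 : (0 : ℝ) < Real.pi * ((n * (n + 1) : ℤ) : ℝ) :=
        mul_pos Real.pi_pos (by exact_mod_cast h0)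
      refine (tendsto_exp_imInfty h1).congr fun τ => ?_
      push_cast
      ring_nf
  · filter_upwards [eventually_imInfty_im_gt 1] with τ hτ n
    rw [jacobiTheta₂_term, Complex.norm_exp, Complex.norm_exp, Real.exp_le_exp]
    have e1 : (Real.pi * I * ((n * (n + 1) : ℤ) : ℂ) * τ).re =
        -(Real.pi * ((n * (n + 1) : ℤ) : ℝ)) * τ.im := by
      rw [show (Real.pi * I * ((n * (n + 1) : ℤ) : ℂ) * τ : ℂ) =
        ((Real.pi * ((n * (n + 1) : ℤ) : ℝ) : ℝ) : ℂ) * (τ * I) by push_cast; ring,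
        re_ofReal_mul, mul_I_re]
      ring
    have e2 : (2 * Real.pi * I * n * (I / 2) + Real.pi * I * n ^ 2 * I : ℂ).re =
        -(Real.pi * ((n * (n + 1) : ℤ) : ℝ)) * 1 := by
      rw [show (2 * Real.pi * I * n * (I / 2) + Real.pi * I * n ^ 2 * I : ℂ) =
        ((Real.pi * ((n * (n + 1) : ℤ) : ℝ) : ℝ) : ℂ) * (I * I) by push_cast; ring,
        re_ofReal_mul, mul_I_re]
      simp
    rw [e1, e2]
    have h1 : (0 : ℝ) ≤ Real.pi * ((n * (n + 1) : ℤ) : ℝ) :=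
      mul_nonneg Real.pi_pos.le (by exact_mod_cast hnn n)
    nlinarith

lemma tendsto_eulerProd_imInfty : Tendsto eulerProd imInfty (𝓝 1) := by
  have htprod : Tendsto (fun q : ℂ => ∏' n : ℕ, (1 - q ^ (n + 1))) (𝓝 0) (𝓝 1) := by
    have h := ModularForm.differentiableOn_tprod_one_sub_pow.differentiableAt
      (Metric.ball_mem_nhds (0 : ℂ) one_pos)
    simpa using h.continuousAt.tendsto
  exact htprod.comp ((Function.Periodic.qParam_tendsto one_pos).mono_right nhdsWithin_le_nhds)

/-! ### Theta identities from invariance under the modular group -/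

lemma eta_ne_zero' {τ : ℂ} (hτ : 0 < τ.im) : ModularForm.eta τ ≠ 0 := ModularForm.eta_ne_zero hτ

lemma differentiableOn_eta : DifferentiableOn ℂ ModularForm.eta {τ | 0 < τ.im} := fun _ hτ =>
  (ModularForm.differentiableAt_eta_of_mem_upperHalfPlaneSet hτ).differentiableWithinAt

lemma differentiableOn_theta3 : DifferentiableOn ℂ theta3 {τ | 0 < τ.im} := fun _ hτ =>
  (differentiableAt_jacobiTheta hτ).differentiableWithinAt

lemma differentiableOn_theta4 : DifferentiableOn ℂ theta4 {τ | 0 < τ.im} := by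
  rw [show theta4 = fun τ => jacobiTheta₂ (1 / 2) τ from funext theta4_eq]
  exact fun _ hτ => (differentiableAt_jacobiTheta₂_snd _ hτ).differentiableWithinAt

lemma differentiableOn_theta2Series : DifferentiableOn ℂ theta2Series {τ | 0 < τ.im} := by
  intro τ hτ
  have h1 := (hasFDerivAt_jacobiTheta₂ (τ / 2) hτ).differentiableAt
  have h2 : DifferentiableAt ℂ (fun t : ℂ => (t / 2, t)) τ := by fun_prop
  exact (DifferentiableAt.comp (f := fun t : ℂ => (t / 2, t)) τ h1 h2).differentiableWithinAt

lemma differentiableOn_theta2 : DifferentiableOn ℂ theta2 {τ | 0 < τ.im} := by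
  have : DifferentiableOn ℂ (fun τ : ℂ => cexp (Real.pi * I * τ / 4)) {τ | 0 < τ.im} := by
    fun_prop
  exact this.mul differentiableOn_theta2Series

/-- Jacobi's identity. The cube of the difference of the two sides has the same transformation
behaviour as `η ^ 12`, and vanishes to higher order at the cusp. -/
theorem jacobi_identity {τ : ℂ} (hτ : 0 < τ.im) :
    theta3 τ ^ 4 = theta2 τ ^ 4 + theta4 τ ^ 4 := by
  set H : ℂ → ℂ := fun τ => theta3 τ ^ 4 - theta2 τ ^ 4 - theta4 τ ^ 4 with hH
  have hHd : DifferentiableOn ℂ H {τ | 0 < τ.im} :=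
    ((differentiableOn_theta3.pow 4).sub (differentiableOn_theta2.pow 4)).sub
      (differentiableOn_theta4.pow 4)
  have hO4 : ∀ {f : ℂ → ℂ}, Tendsto f imInfty (𝓝 1) →
      (fun τ => f τ - 1) =O[imInfty] (fun τ => cexp (Real.pi * I * τ)) →
      (fun τ => f τ ^ 4 - 1) =O[imInfty] fun τ => cexp (Real.pi * I * τ) := by
    intro f hf hO
    have h1 : (fun τ => f τ ^ 3 + f τ ^ 2 + f τ + 1) =O[imInfty] fun _ => (1 : ℂ) :=
      ((((hf.pow 3).add (hf.pow 2)).add hf).add_const 1).isBigO_one ℂ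
    refine (hO.mul h1).congr (fun τ => by ring) fun τ => by ring
  have hHO : H =O[imInfty] fun τ => cexp (Real.pi * I * τ) := by
    have h2 : (fun τ => theta2 τ ^ 4) =O[imInfty] fun τ => cexp (Real.pi * I * τ) := by
      have := (Asymptotics.isBigO_refl (fun τ : ℂ => cexp (Real.pi * I * τ)) imInfty).mul
        ((tendsto_theta2Series_imInfty.pow 4).isBigO_one ℂ)
      exact this.congr (fun τ => (theta2_pow_four τ).symm) fun τ => by ring
    refine (((hO4 tendsto_theta3_imInfty theta3_sub_one_isBigO).sub
      (hO4 tendsto_theta4_imInfty theta4_sub_one_isBigO)).sub h2).congr (fun τ => ?_) fun τ => rfl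
    simp only [hH]
    ring
  have hinv : H τ ^ 3 / ModularForm.eta τ ^ 12 = 0 := by
    refine eq_of_modular_invariant (f := fun τ => H τ ^ 3 / ModularForm.eta τ ^ 12)
      ((hHd.pow 3).div (differentiableOn_eta.pow 12) fun τ hτ => pow_ne_zero _ (eta_ne_zero' hτ))
      ?_ ?_ ?_ hτ
    · intro τ _
      have : H (τ + 1) = -H τ := by
        simp only [hH, theta3_add_one, theta4_add_one, theta2_add_one_pow_four]
        ring
      simp only [this, eta_add_one_pow_twelve]
      rw [Odd.neg_pow (by decide), neg_div_neg_eq]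
    · intro τ hτ
      have hτ0 : τ ≠ 0 := by rintro rfl; simp at hτ
      have : H (-1 / τ) = -τ ^ 2 * H τ := by
        simp only [hH, theta3_S_pow_four hτ, theta4_S_pow_four hτ, theta2_S_pow_four hτ]
        ring
      simp only [this, eta_S_pow_twelve hτ]
      have := eta_ne_zero' hτ
      field_simp
    · have hP : Tendsto (fun τ => (eulerProd τ ^ 12)⁻¹) imInfty (𝓝 1) := by
        simpa using (tendsto_eulerProd_imInfty.pow 12).inv₀ (by norm_num)
      -- `H ^ 3` has order at least `3` in `exp (π i τ)`, and `η ^ 12` has order `1`.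
      have h3 := (hHO.pow 3).mul (Asymptotics.isBigO_refl
        (fun τ : ℂ => (ModularForm.eta τ ^ 12)⁻¹) imInfty)
      refine h3.trans_tendsto ?_
      have h4 := ((tendsto_exp_imInfty Real.pi_pos).pow 2).mul hP
      rw [zero_pow two_ne_zero, zero_mul] at h4
      refine h4.congr fun τ => ?_
      rw [eta_pow_twelve]
      have := Complex.exp_ne_zero (Real.pi * I * τ)
      rw [mul_inv]
      field_simp
  rw [div_eq_zero_iff, or_iff_left (pow_ne_zero _ (eta_ne_zero' hτ))] at hinv
  have h0 : H τ = 0 := by simpa using hinv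
  linear_combination h0

/-- The fourth power of the product formula `θ₂ θ₃ θ₄ = 2 η³`. -/
theorem theta_mul_theta_mul_theta_pow_four {τ : ℂ} (hτ : 0 < τ.im) :
    (theta2 τ * theta3 τ * theta4 τ) ^ 4 = 16 * ModularForm.eta τ ^ 12 := by
  have hinv : (theta2 τ * theta3 τ * theta4 τ) ^ 4 / ModularForm.eta τ ^ 12 = 16 := by
    refine eq_of_modular_invariant
      (f := fun τ => (theta2 τ * theta3 τ * theta4 τ) ^ 4 / ModularForm.eta τ ^ 12)
      ((((differentiableOn_theta2.mul differentiableOn_theta3).mul differentiableOn_theta4).pow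
        4).div (differentiableOn_eta.pow 12) fun τ hτ => pow_ne_zero _ (eta_ne_zero' hτ))
      ?_ ?_ ?_ hτ
    · intro τ _
      simp only [mul_pow, theta2_add_one_pow_four, theta3_add_one, theta4_add_one,
        eta_add_one_pow_twelve]
      rw [← neg_div_neg_eq]
      ring
    · intro τ hτ
      have hτ0 : τ ≠ 0 := by rintro rfl; simp at hτ
      have := eta_ne_zero' hτ
      simp only [mul_pow, theta2_S_pow_four hτ, theta3_S_pow_four hτ, theta4_S_pow_four hτ,
        eta_S_pow_twelve hτ]
      field_simp
    · have h := (((tendsto_theta2Series_imInfty.pow 4).mul (tendsto_theta3_imInfty.pow 4)).mul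
        (tendsto_theta4_imInfty.pow 4)).div (tendsto_eulerProd_imInfty.pow 12) (by norm_num)
      norm_num at h
      refine h.congr fun τ => ?_
      simp only [Pi.div_apply]
      rw [mul_pow, mul_pow, theta2_pow_four, eta_pow_twelve, mul_assoc (cexp _),
        mul_assoc (cexp _), mul_div_mul_left _ _ (Complex.exp_ne_zero _)]
  rwa [div_eq_iff (pow_ne_zero _ (eta_ne_zero' hτ))] at hinv

lemma theta_mul_ne_zero {τ : ℂ} (hτ : 0 < τ.im) : theta2 τ * theta3 τ * theta4 τ ≠ 0 := by
  intro h
  have h1 := theta_mul_theta_mul_theta_pow_four hτ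
  rw [h] at h1
  exact pow_ne_zero 12 (eta_ne_zero' hτ) (by simpa using h1.symm)

lemma theta2_ne_zero {τ : ℂ} (hτ : 0 < τ.im) : theta2 τ ≠ 0 :=
  left_ne_zero_of_mul (left_ne_zero_of_mul (theta_mul_ne_zero hτ))

lemma theta3_ne_zero {τ : ℂ} (hτ : 0 < τ.im) : theta3 τ ≠ 0 :=
  right_ne_zero_of_mul (left_ne_zero_of_mul (theta_mul_ne_zero hτ))

lemma theta4_ne_zero {τ : ℂ} (hτ : 0 < τ.im) : theta4 τ ≠ 0 :=
  right_ne_zero_of_mul (theta_mul_ne_zero hτ)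

/-! ### The modular lambda function -/

lemma one_sub_modularLambda {τ : ℂ} (hτ : 0 < τ.im) :
    1 - modularLambda τ = theta4 τ ^ 4 / theta3 τ ^ 4 := by
  have := theta3_ne_zero hτ
  rw [modularLambda, eq_div_iff (pow_ne_zero _ this), sub_mul,
    div_mul_cancel₀ _ (pow_ne_zero _ this)]
  linear_combination jacobi_identity hτ

lemma modularLambda_ne_zero {τ : ℂ} (hτ : 0 < τ.im) : modularLambda τ ≠ 0 :=
  div_ne_zero (pow_ne_zero _ (theta2_ne_zero hτ)) (pow_ne_zero _ (theta3_ne_zero hτ))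

lemma one_sub_modularLambda_ne_zero {τ : ℂ} (hτ : 0 < τ.im) : 1 - modularLambda τ ≠ 0 := by
  rw [one_sub_modularLambda hτ]
  exact div_ne_zero (pow_ne_zero _ (theta4_ne_zero hτ)) (pow_ne_zero _ (theta3_ne_zero hτ))

lemma differentiableOn_modularLambda : DifferentiableOn ℂ modularLambda {τ | 0 < τ.im} :=
  (differentiableOn_theta2.pow 4).div (differentiableOn_theta3.pow 4)
    fun _ hτ => pow_ne_zero _ (theta3_ne_zero hτ)

lemma differentiableAt_modularLambda {τ : ℂ} (hτ : 0 < τ.im) :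
    DifferentiableAt ℂ modularLambda τ :=
  differentiableOn_modularLambda.differentiableAt (isOpen_im_pos.mem_nhds hτ)

lemma modularLambda_S {τ : ℂ} (hτ : 0 < τ.im) :
    modularLambda (-1 / τ) = 1 - modularLambda τ := by
  have hτ0 : τ ≠ 0 := by rintro rfl; simp at hτ
  rw [one_sub_modularLambda hτ, modularLambda, theta2_S_pow_four hτ, theta3_S_pow_four hτ,
    mul_div_mul_left]
  simpa using hτ0

lemma modularLambda_T {τ : ℂ} (hτ : 0 < τ.im) :
    modularLambda (τ + 1) = -(modularLambda τ / (1 - modularLambda τ)) := by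
  have := theta3_ne_zero hτ
  rw [one_sub_modularLambda hτ, modularLambda, modularLambda, theta2_add_one_pow_four,
    theta3_add_one, div_div_div_cancel_right₀ (pow_ne_zero _ this), neg_div]

lemma deriv_modularLambda_S {τ : ℂ} (hτ : 0 < τ.im) :
    deriv modularLambda (-1 / τ) = -τ ^ 2 * deriv modularLambda τ := by
  have hτ0 : τ ≠ 0 := by rintro rfl; simp at hτ
  have h1 : HasDerivAt (fun t : ℂ => -1 / t) (1 / τ ^ 2) τ := by
    have := (hasDerivAt_inv hτ0).const_mul (-1)
    simpa [div_eq_mul_inv] using this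
  have h2 := (differentiableAt_modularLambda (im_neg_one_div_pos hτ)).hasDerivAt.comp τ h1
  have h3 := (differentiableAt_modularLambda hτ).hasDerivAt.const_sub 1
  have heq : (modularLambda ∘ fun t : ℂ => -1 / t) =ᶠ[𝓝 τ] fun t => 1 - modularLambda t := by
    filter_upwards [isOpen_im_pos.mem_nhds hτ] with t ht using modularLambda_S ht
  have h4 := h2.unique (h3.congr_of_eventuallyEq heq)
  rw [mul_one_div, div_eq_iff (pow_ne_zero 2 hτ0)] at h4
  linear_combination h4

lemma deriv_modularLambda_T {τ : ℂ} (hτ : 0 < τ.im) :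
    deriv modularLambda (τ + 1) = -(deriv modularLambda τ / (1 - modularLambda τ) ^ 2) := by
  have hτ1 : 0 < (τ + 1).im := by simpa using hτ
  have h1 := (differentiableAt_modularLambda hτ1).hasDerivAt.comp_add_const τ 1
  have h3 := (differentiableAt_modularLambda hτ).hasDerivAt
  have h5 := (h3.div (h3.const_sub 1) (one_sub_modularLambda_ne_zero hτ)).neg
  have heq : (fun t : ℂ => modularLambda (t + 1)) =ᶠ[𝓝 τ]
      -(modularLambda / fun t => 1 - modularLambda t) := by
    filter_upwards [isOpen_im_pos.mem_nhds hτ] with t ht using modularLambda_T ht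
  rw [h1.unique (h5.congr_of_eventuallyEq heq)]
  ring

lemma modularLambda_eq (τ : ℂ) :
    modularLambda τ = cexp (Real.pi * I * τ) * (theta2Series τ ^ 4 / theta3 τ ^ 4) := by
  rw [modularLambda, theta2_pow_four, mul_div_assoc]

lemma tendsto_theta2Series_div_theta3 :
    Tendsto (fun τ => theta2Series τ ^ 4 / theta3 τ ^ 4) imInfty (𝓝 16) := by
  have h := (tendsto_theta2Series_imInfty.pow 4).div (tendsto_theta3_imInfty.pow 4) (by norm_num)
  norm_num at h
  exact h

lemma tendsto_modularLambda_imInfty : Tendsto modularLambda imInfty (𝓝 0) := by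
  have h := (tendsto_exp_imInfty Real.pi_pos).mul tendsto_theta2Series_div_theta3
  rw [zero_mul] at h
  exact h.congr fun τ => (modularLambda_eq τ).symm

lemma tendsto_deriv_modularLambda_div :
    Tendsto (fun τ => deriv modularLambda τ / modularLambda τ) imInfty (𝓝 (Real.pi * I)) := by
  set G : ℂ → ℂ := fun τ => theta2Series τ ^ 4 / theta3 τ ^ 4 with hG
  have hGd : DifferentiableOn ℂ G {τ | 0 < τ.im} :=
    (differentiableOn_theta2Series.pow 4).div (differentiableOn_theta3.pow 4)
      fun _ hτ => pow_ne_zero _ (theta3_ne_zero hτ)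
  have h := ((tendsto_deriv_imInfty hGd tendsto_theta2Series_div_theta3).div
    tendsto_theta2Series_div_theta3 (by norm_num)).const_add (Real.pi * I : ℂ)
  rw [zero_div, add_zero] at h
  refine h.congr' ?_
  filter_upwards [eventually_imInfty_im_gt 0] with τ hτ
  have h1 : HasDerivAt (fun t : ℂ => cexp (Real.pi * I * t))
      (cexp (Real.pi * I * τ) * (Real.pi * I)) τ := by
    simpa using ((hasDerivAt_id τ).const_mul (Real.pi * I : ℂ)).cexp
  have h2 := (hGd.differentiableAt (isOpen_im_pos.mem_nhds hτ)).hasDerivAt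
  have h3 : HasDerivAt modularLambda _ τ :=
    (h1.mul h2).congr_of_eventuallyEq (Eventually.of_forall modularLambda_eq)
  have hG0 : G τ ≠ 0 := right_ne_zero_of_mul (modularLambda_eq τ ▸ modularLambda_ne_zero hτ)
  have hE := Complex.exp_ne_zero (Real.pi * I * τ)
  rw [h3.deriv, modularLambda_eq τ]
  change Real.pi * I + deriv G τ / G τ = _ / (_ * G τ)
  field_simp

/-- The differential equation `λ' = π i λ (1 - λ) θ₃⁴`: the quotient of the two sides is invariant
under the modular group. -/
theorem deriv_modularLambda {τ : ℂ} (hτ : 0 < τ.im) : deriv modularLambda τ =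
    Real.pi * I * (modularLambda τ * (1 - modularLambda τ) * theta3 τ ^ 4) := by
  have hne : ∀ τ : ℂ, 0 < τ.im →
      modularLambda τ * (1 - modularLambda τ) * theta3 τ ^ 4 ≠ 0 := fun τ hτ =>
    mul_ne_zero (mul_ne_zero (modularLambda_ne_zero hτ) (one_sub_modularLambda_ne_zero hτ))
      (pow_ne_zero _ (theta3_ne_zero hτ))
  have hinv : deriv modularLambda τ / (modularLambda τ * (1 - modularLambda τ) * theta3 τ ^ 4) =
      Real.pi * I := by
    refine eq_of_modular_invariant (f := fun τ => deriv modularLambda τ /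
      (modularLambda τ * (1 - modularLambda τ) * theta3 τ ^ 4)) ?_ ?_ ?_ ?_ hτ
    · exact (differentiableOn_modularLambda.deriv isOpen_im_pos).div
        ((differentiableOn_modularLambda.mul (differentiableOn_modularLambda.const_sub 1)).mul
          (differentiableOn_theta3.pow 4)) hne
    · intro τ hτ
      have h1 := theta3_ne_zero hτ
      have h2 := modularLambda_ne_zero hτ
      have h3 := one_sub_modularLambda_ne_zero hτ
      have h4 : theta4 τ ^ 4 = (1 - modularLambda τ) * theta3 τ ^ 4 := by
        rw [one_sub_modularLambda hτ]
        field_simp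
      have h5 : 1 - -(modularLambda τ / (1 - modularLambda τ)) = 1 / (1 - modularLambda τ) := by
        field_simp
        ring
      simp only [deriv_modularLambda_T hτ, modularLambda_T hτ, theta3_add_one, h4, h5]
      field_simp
    · intro τ hτ
      have hτ0 : τ ≠ 0 := by rintro rfl; simp at hτ
      have h1 := theta3_ne_zero hτ
      have h2 := modularLambda_ne_zero hτ
      have h3 := one_sub_modularLambda_ne_zero hτ
      simp only [deriv_modularLambda_S hτ, modularLambda_S hτ, theta3_S_pow_four hτ, sub_sub_cancel]
      field_simp
    · have h := tendsto_deriv_modularLambda_div.div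
        ((tendsto_modularLambda_imInfty.const_sub 1).mul (tendsto_theta3_imInfty.pow 4))
        (by norm_num)
      norm_num at h
      refine h.congr fun τ => ?_
      simp only [Pi.div_apply]
      rw [div_div, mul_assoc]
  rwa [div_eq_iff (hne τ hτ)] at hinv

/-! ### The primitive of the fourth power of eta -/

lemma exists_norm_eta_pow_four_le {c : ℝ} (hc : 0 < c) : ∃ C : ℝ, 0 ≤ C ∧
    ∀ z : ℂ, c ≤ z.im → ‖ModularForm.eta z ^ 4‖ ≤ C * Real.exp (-(Real.pi / 3) * z.im) := by
  -- On `c ≤ Im z` the nome stays in the compact disc of radius `exp (-2 π c) < 1`.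
  set ρ : ℝ := Real.exp (-2 * Real.pi * c) with hρ
  have hρ1 : ρ < 1 := by
    rw [hρ, Real.exp_lt_one_iff]
    have := mul_pos Real.pi_pos hc
    linarith
  obtain ⟨M, hM⟩ := (isCompact_closedBall (0 : ℂ) ρ).exists_bound_of_continuousOn
    (ModularForm.differentiableOn_tprod_one_sub_pow.continuousOn.mono
      (Metric.closedBall_subset_ball hρ1))
  refine ⟨(max M 0) ^ 4, by positivity, fun z hz => ?_⟩
  have hq : Function.Periodic.qParam 1 z ∈ Metric.closedBall (0 : ℂ) ρ := by
    rw [mem_closedBall_zero_iff, Function.Periodic.norm_qParam, div_one, hρ, Real.exp_le_exp]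
    have := mul_le_mul_of_nonneg_left hz Real.pi_pos.le
    linarith
  have hE : ‖eulerProd z‖ ≤ max M 0 := (hM _ hq).trans (le_max_left _ _)
  have h1 : ‖cexp (Real.pi * I * z / 3)‖ = Real.exp (-(Real.pi / 3) * z.im) := by
    rw [Complex.norm_exp, show (Real.pi * I * z / 3 : ℂ) = ((Real.pi / 3 : ℝ) : ℂ) * (z * I) by
      push_cast; ring, re_ofReal_mul, mul_I_re]
    ring_nf
  rw [eta_pow_four, norm_mul, norm_pow, h1, mul_comm]
  gcongr

lemma differentiableOn_eta_pow_four :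
    DifferentiableOn ℂ (fun z => ModularForm.eta z ^ 4) {τ | 0 < τ.im} :=
  differentiableOn_eta.pow 4

lemma hasDerivAt_eta_pow_four {z : ℂ} (hz : 0 < z.im) :
    HasDerivAt (fun z => ModularForm.eta z ^ 4) (deriv (fun z => ModularForm.eta z ^ 4) z) z :=
  (differentiableOn_eta_pow_four.differentiableAt (isOpen_im_pos.mem_nhds hz)).hasDerivAt

/-- Cauchy's estimate on discs of radius `c` carries the exponential decay over to the
derivative. -/
lemma exists_norm_deriv_eta_pow_four_le {c : ℝ} (hc : 0 < c) : ∃ C : ℝ, 0 ≤ C ∧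
    ∀ z : ℂ, 2 * c ≤ z.im → ‖deriv (fun z => ModularForm.eta z ^ 4) z‖ ≤
      C * Real.exp (-(Real.pi / 3) * z.im) := by
  obtain ⟨C, hC0, hC⟩ := exists_norm_eta_pow_four_le hc
  refine ⟨C * Real.exp (Real.pi / 3 * c) / c, by positivity, fun z hz => ?_⟩
  have him : ∀ w ∈ Metric.closedBall z c, z.im - c ≤ w.im := by
    intro w hw
    have h2 := (abs_im_le_norm (w - z)).trans (by simpa [dist_eq_norm] using hw)
    rw [sub_im, abs_le] at h2
    linarith [h2.1]
  have hdc : DiffContOnCl ℂ (fun z => ModularForm.eta z ^ 4) (Metric.ball z c) := by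
    refine DifferentiableOn.diffContOnCl ?_
    rw [closure_ball z hc.ne']
    exact differentiableOn_eta_pow_four.mono fun w hw => by
      have := him w hw
      simp only [Set.mem_ofPred_eq]
      linarith
  refine (norm_deriv_le_of_forall_mem_sphere_norm_le hc hdc
    (C := C * Real.exp (Real.pi / 3 * c) * Real.exp (-(Real.pi / 3) * z.im))
    fun w hw => ?_).trans_eq (by ring)
  have hw' := him w (Metric.sphere_subset_closedBall hw)
  refine (hC w (by linarith)).trans ?_
  rw [mul_assoc, ← Real.exp_add]
  gcongr
  have := mul_le_mul_of_nonneg_left hw' Real.pi_pos.le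
  linarith

lemma im_add_ofReal_mul_I (τ : ℂ) (t : ℝ) : (τ + t * I).im = τ.im + t := by simp

lemma continuousOn_ray {f : ℂ → ℂ} (hf : ContinuousOn f {τ | 0 < τ.im}) {τ : ℂ}
    (hτ : 0 < τ.im) : ContinuousOn (fun t : ℝ => f (τ + t * I) * I) (Set.Ioi 0) := by
  refine ContinuousOn.mul (hf.comp (by fun_prop) fun t ht => ?_) continuousOn_const
  rw [Set.mem_ofPred_eq, im_add_ofReal_mul_I]
  exact add_pos hτ ht

lemma integrableOn_exp_ray (C : ℝ) :
    IntegrableOn (fun t : ℝ => C * Real.exp (-(Real.pi / 3) * t)) (Set.Ioi 0) :=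
  (exp_neg_integrableOn_Ioi 0 (by positivity)).const_mul C

lemma integrableOn_eta_pow_four {τ : ℂ} (hτ : 0 < τ.im) :
    IntegrableOn (fun t : ℝ => ModularForm.eta (τ + t * I) ^ 4 * I) (Set.Ioi 0) := by
  obtain ⟨C, hC0, hC⟩ := exists_norm_eta_pow_four_le hτ
  refine Integrable.mono' (integrableOn_exp_ray C) ((continuousOn_ray
    differentiableOn_eta_pow_four.continuousOn hτ).aestronglyMeasurable measurableSet_Ioi) ?_
  filter_upwards [ae_restrict_mem measurableSet_Ioi] with t (ht : 0 < t)
  rw [norm_mul, norm_I, mul_one]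
  refine (hC _ (by rw [im_add_ofReal_mul_I]; linarith)).trans ?_
  rw [im_add_ofReal_mul_I]
  gcongr ?_ * Real.exp ?_
  have := mul_pos Real.pi_pos hτ
  linarith

lemma tendsto_eta_pow_four_imInfty :
    Tendsto (fun z => ModularForm.eta z ^ 4) imInfty (𝓝 0) := by
  have h := (tendsto_exp_imInfty (a := Real.pi / 3) (by positivity)).mul
    (tendsto_eulerProd_imInfty.pow 4)
  rw [zero_mul] at h
  refine h.congr fun τ => ?_
  rw [eta_pow_four]
  congr 2
  push_cast
  ring

lemma tendsto_ray_imInfty (τ : ℂ) : Tendsto (fun t : ℝ => τ + t * I) atTop imInfty := by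
  rw [tendsto_comap_iff]
  exact (tendsto_atTop_add_const_left _ τ.im tendsto_id).congr fun t =>
    (im_add_ofReal_mul_I τ t).symm

/-- Differentiation under the integral sign turns the integrand into the derivative of
`η⁴` along the ray, which integrates to `-η(τ)⁴`. -/
lemma hasDerivAt_etaFourPrimitive {τ : ℂ} (hτ : 0 < τ.im) :
    HasDerivAt etaFourPrimitive (ModularForm.eta τ ^ 4) τ := by
  set e' : ℂ → ℂ := deriv fun z => ModularForm.eta z ^ 4 with he'
  have hc : 0 < τ.im / 4 := by positivity
  obtain ⟨C, hC0, hC⟩ := exists_norm_deriv_eta_pow_four_le hc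
  have he'c : ContinuousOn e' {τ | 0 < τ.im} :=
    (differentiableOn_eta_pow_four.deriv isOpen_im_pos).continuousOn
  have him : ∀ x ∈ Metric.ball τ (τ.im / 2), 2 * (τ.im / 4) < x.im := by
    intro x hx
    have h2 := (abs_im_le_norm (x - τ)).trans_lt (by simpa [dist_eq_norm] using hx)
    rw [sub_im, abs_lt] at h2
    linarith [h2.1]
  have hbd : ∀ t : ℝ, 0 < t → ∀ x ∈ Metric.ball τ (τ.im / 2),
      ‖e' (x + t * I) * I‖ ≤ C * Real.exp (-(Real.pi / 3) * t) := by
    intro t ht x hx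
    have hx' := him x hx
    rw [norm_mul, norm_I, mul_one]
    refine (hC _ (by rw [im_add_ofReal_mul_I]; linarith)).trans ?_
    rw [im_add_ofReal_mul_I]
    gcongr ?_ * Real.exp ?_
    have := mul_pos Real.pi_pos (hc.trans (by linarith : τ.im / 4 < x.im))
    linarith
  have hray := fun (x : ℂ) (hx : 0 < x.im) => (continuousOn_ray
    differentiableOn_eta_pow_four.continuousOn hx).aestronglyMeasurable (μ := volume)
      measurableSet_Ioi
  have key := (hasDerivAt_integral_of_dominated_loc_of_deriv_le
    (μ := volume.restrict (Set.Ioi (0 : ℝ)))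
    (F := fun x t => ModularForm.eta (x + t * I) ^ 4 * I)
    (F' := fun x t => e' (x + t * I) * I) (x₀ := τ)
    (bound := fun t => C * Real.exp (-(Real.pi / 3) * t))
    (Metric.ball_mem_nhds τ (by positivity : 0 < τ.im / 2))
    (by filter_upwards [isOpen_im_pos.mem_nhds hτ] with x hx using hray x hx)
    (integrableOn_eta_pow_four hτ)
    ((continuousOn_ray he'c hτ).aestronglyMeasurable measurableSet_Ioi)
    (by filter_upwards [ae_restrict_mem measurableSet_Ioi] with t ht using hbd t ht)
    (integrableOn_exp_ray C)
    (by
      filter_upwards [ae_restrict_mem measurableSet_Ioi] with t (ht : 0 < t) x hx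
      have h1 := him x hx
      have h2 : 0 < (x + t * I).im := by rw [im_add_ofReal_mul_I]; linarith
      exact ((hasDerivAt_eta_pow_four h2).comp_add_const x (t * I)).mul_const I))
  have hFTC : ∫ t in Set.Ioi (0 : ℝ), e' (τ + t * I) * I = 0 - ModularForm.eta τ ^ 4 := by
    have h := integral_Ioi_of_hasDerivAt_of_tendsto' (a := 0)
      (f := fun t : ℝ => ModularForm.eta (τ + t * I) ^ 4)
      (f' := fun t : ℝ => e' (τ + t * I) * I) (m := 0) ?_ key.1
      (tendsto_eta_pow_four_imInfty.comp (tendsto_ray_imInfty τ))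
    · simpa using h
    · intro t ht
      have h2 : 0 < (τ + t * I).im := by
        rw [im_add_ofReal_mul_I]
        exact add_pos_of_pos_of_nonneg hτ ht
      have h3 : HasDerivAt (fun t : ℝ => τ + (t : ℂ) * I) I t := by
        simpa using ((hasDerivAt_id t).ofReal_comp.mul_const I).const_add τ
      exact (hasDerivAt_eta_pow_four h2).comp t h3
  have h := key.2.neg
  rw [hFTC, zero_sub, neg_neg] at h
  exact h

lemma tendsto_etaFourPrimitive_imInfty : Tendsto etaFourPrimitive imInfty (𝓝 0) := by
  obtain ⟨C, hC0, hC⟩ := exists_norm_eta_pow_four_le one_pos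
  have hlim : Tendsto (fun τ : ℂ => Real.exp (-(Real.pi / 3 * τ.im)) *
      ∫ t in Set.Ioi (0 : ℝ), C * Real.exp (-(Real.pi / 3) * t)) imInfty (𝓝 0) := by
    have := (Real.tendsto_exp_neg_atTop_nhds_zero.comp
      ((tendsto_comap (f := Complex.im)).const_mul_atTop
        (by positivity : 0 < Real.pi / 3))).mul_const
      (∫ t in Set.Ioi (0 : ℝ), C * Real.exp (-(Real.pi / 3) * t))
    rwa [zero_mul] at this
  refine squeeze_zero_norm' ?_ hlim
  filter_upwards [eventually_imInfty_im_gt 1] with τ hτ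
  rw [etaFourPrimitive, norm_neg, ← integral_const_mul]
  refine norm_integral_le_of_norm_le ((integrableOn_exp_ray C).const_mul _) ?_
  filter_upwards [ae_restrict_mem measurableSet_Ioi] with t (ht : 0 < t)
  rw [norm_mul, norm_I, mul_one]
  refine (hC _ (by rw [im_add_ofReal_mul_I]; linarith)).trans_eq ?_
  rw [im_add_ofReal_mul_I, mul_left_comm, ← Real.exp_add]
  ring_nf

/-! ### The cube root and the hypergeometric primitive -/

/-- The branch of the cube root of `λ (1 - λ) / 2`, written as `2 η⁴ / θ₃⁴`, which makes it
holomorphic on the whole upper half-plane. -/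
def cubeRoot (τ : ℂ) : ℂ := 2 * ModularForm.eta τ ^ 4 / theta3 τ ^ 4

lemma cubeRoot_pow_three {τ : ℂ} (hτ : 0 < τ.im) :
    cubeRoot τ ^ 3 = 1 / 2 * (modularLambda τ * (1 - modularLambda τ)) := by
  have h := theta_mul_theta_mul_theta_pow_four hτ
  have h3 := theta3_ne_zero hτ
  rw [one_sub_modularLambda hτ, modularLambda, cubeRoot]
  field_simp
  linear_combination -h

lemma cubeRoot_ne_zero {τ : ℂ} (hτ : 0 < τ.im) : cubeRoot τ ≠ 0 :=
  div_ne_zero (mul_ne_zero two_ne_zero (pow_ne_zero _ (eta_ne_zero' hτ)))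
    (pow_ne_zero _ (theta3_ne_zero hτ))

lemma differentiableOn_cubeRoot : DifferentiableOn ℂ cubeRoot {τ | 0 < τ.im} :=
  (differentiableOn_eta_pow_four.const_mul 2).div (differentiableOn_theta3.pow 4)
    fun _ hτ => pow_ne_zero _ (theta3_ne_zero hτ)

lemma tendsto_cubeRoot_imInfty : Tendsto cubeRoot imInfty (𝓝 0) := by
  have h := (tendsto_eta_pow_four_imInfty.const_mul 2).div (tendsto_theta3_imInfty.pow 4)
    (by norm_num)
  rw [mul_zero, zero_div] at h
  exact h

/-- Differentiate `r ^ 3 = λ (1 - λ) / 2` and use the differential equation of `λ`. -/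
lemma deriv_cubeRoot {τ : ℂ} (hτ : 0 < τ.im) :
    3 * deriv cubeRoot τ = Real.pi * I * ((1 - 2 * modularLambda τ) * cubeRoot τ * theta3 τ ^ 4)
      := by
  have h1 := ((differentiableOn_cubeRoot.differentiableAt
    (isOpen_im_pos.mem_nhds hτ)).hasDerivAt).pow 3
  have hl := (differentiableAt_modularLambda hτ).hasDerivAt
  have h2 := (hl.mul (hl.const_sub 1)).const_mul (1 / 2)
  have heq : cubeRoot ^ 3 =ᶠ[𝓝 τ]
      fun t => 1 / 2 * (modularLambda * fun t => 1 - modularLambda t) t := by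
    filter_upwards [isOpen_im_pos.mem_nhds hτ] with t ht using cubeRoot_pow_three ht
  have h3 := h1.unique (h2.congr_of_eventuallyEq heq)
  rw [deriv_modularLambda hτ] at h3
  have hr := cubeRoot_ne_zero hτ
  have hr3 := cubeRoot_pow_three hτ
  refine mul_left_cancel₀ (pow_ne_zero 2 hr) ?_
  norm_num at h3
  linear_combination h3 - Real.pi * I * (1 - 2 * modularLambda τ) * theta3 τ ^ 4 * hr3

/-- The closed form `3 / (2π i) (λ (1 - λ) / 2) ^ (1/3) ₂F₁(2/3, 1; 4/3; λ)` is a primitive of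
`η⁴` wherever `|λ| < 1`. -/
lemma hasDerivAt_cubeRoot_mul_tailSeries {τ : ℂ} (hτ : 0 < τ.im) (hl : ‖modularLambda τ‖ < 1) :
    HasDerivAt (fun τ => 3 / (2 * Real.pi * I) * cubeRoot τ * tailSeries 1 (modularLambda τ))
      (ModularForm.eta τ ^ 4) τ := by
  obtain ⟨d, hd, hode⟩ := exists_hasDerivAt_tailSeries_one hl
  have h1 := (differentiableOn_cubeRoot.differentiableAt (isOpen_im_pos.mem_nhds hτ)).hasDerivAt
  have h2 := hd.comp τ (differentiableAt_modularLambda hτ).hasDerivAt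
  refine ((h1.const_mul (3 / (2 * Real.pi * I) : ℂ)).mul h2).congr_deriv ?_
  have hπ : (Real.pi : ℂ) ≠ 0 := by exact_mod_cast Real.pi_ne_zero
  have h3 := theta3_ne_zero hτ
  have heta : ModularForm.eta τ ^ 4 = cubeRoot τ * theta3 τ ^ 4 / 2 := by
    rw [cubeRoot]
    field_simp
  have hdr := deriv_cubeRoot hτ
  rw [deriv_modularLambda hτ, heta]
  simp only [Function.comp_apply]
  field_simp
  linear_combination tailSeries 1 (modularLambda τ) * hdr +
    Real.pi * I * cubeRoot τ * theta3 τ ^ 4 * hode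

lemma tendsto_cubeRoot_mul_tailSeries_imInfty :
    Tendsto (fun τ => 3 / (2 * Real.pi * I) * cubeRoot τ * tailSeries 1 (modularLambda τ))
      imInfty (𝓝 0) := by
  obtain ⟨d, hd, -⟩ := exists_hasDerivAt_tailSeries_one (z := 0) (by simp)
  have h := (tendsto_cubeRoot_imInfty.const_mul (3 / (2 * Real.pi * I) : ℂ)).mul
    (hd.continuousAt.tendsto.comp tendsto_modularLambda_imInfty)
  rwa [mul_zero, zero_mul] at h

/-! ### The imaginary axis and the cusp domain -/

lemma im_ofReal_mul_I_pos {t : ℝ} (ht : 0 < t) : 0 < ((t : ℂ) * I).im := by simpa using ht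

/-- The function `jacobiTheta₂` is even in `z`, so it is real on the imaginary axis both for real
and for purely imaginary `z`. -/
lemma exists_ofReal_eq_jacobiTheta₂ {z : ℂ} (t : ℝ)
    (hz : starRingEnd ℂ z = z ∨ starRingEnd ℂ z = -z) :
    ∃ x : ℝ, jacobiTheta₂ z (t * I) = x := by
  rw [← Complex.conj_eq_iff_real, jacobiTheta₂_conj]
  have h : -(starRingEnd ℂ (t * I)) = t * I := by simp
  rw [h]
  rcases hz with hz | hz <;> simp [hz]

lemma exists_pos_ofReal_eq_pow_four {w : ℂ} (hw : w ≠ 0) (h : ∃ x : ℝ, w = x) :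
    ∃ x : ℝ, 0 < x ∧ w ^ 4 = x := by
  obtain ⟨x, rfl⟩ := h
  have hx : x ≠ 0 := by exact_mod_cast hw
  exact ⟨x ^ 4, by positivity, by push_cast; rfl⟩

lemma exists_pos_theta2_pow_four {t : ℝ} (ht : 0 < t) :
    ∃ x : ℝ, 0 < x ∧ theta2 (t * I) ^ 4 = x := by
  refine exists_pos_ofReal_eq_pow_four (theta2_ne_zero (im_ofReal_mul_I_pos ht)) ?_
  obtain ⟨x, hx⟩ := exists_ofReal_eq_jacobiTheta₂ (z := t * I / 2) t
    (Or.inr (by simp [map_ofNat, neg_div]))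
  refine ⟨Real.exp (-(Real.pi * t / 4)) * x, ?_⟩
  rw [theta2, hx, show (Real.pi * I * (t * I) / 4 : ℂ) = ((-(Real.pi * t / 4) : ℝ) : ℂ) by
    push_cast
    linear_combination (Real.pi * t / 4 : ℂ) * I_mul_I]
  push_cast
  rfl

lemma exists_pos_theta3_pow_four {t : ℝ} (ht : 0 < t) :
    ∃ x : ℝ, 0 < x ∧ theta3 (t * I) ^ 4 = x := by
  refine exists_pos_ofReal_eq_pow_four (theta3_ne_zero (im_ofReal_mul_I_pos ht)) ?_
  rw [theta3, jacobiTheta_eq_jacobiTheta₂]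
  exact exists_ofReal_eq_jacobiTheta₂ t (Or.inl (by simp))

lemma exists_pos_theta4_pow_four {t : ℝ} (ht : 0 < t) :
    ∃ x : ℝ, 0 < x ∧ theta4 (t * I) ^ 4 = x := by
  refine exists_pos_ofReal_eq_pow_four (theta4_ne_zero (im_ofReal_mul_I_pos ht)) ?_
  rw [theta4_eq]
  exact exists_ofReal_eq_jacobiTheta₂ t (Or.inl (by simp [map_ofNat]))

lemma exists_pos_eta_pow_four {t : ℝ} (ht : 0 < t) :
    ∃ x : ℝ, 0 < x ∧ ModularForm.eta (t * I) ^ 4 = x := by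
  have hτ := im_ofReal_mul_I_pos ht
  refine exists_pos_ofReal_eq_pow_four (eta_ne_zero' hτ) ?_
  have hq : ∀ h : ℝ, starRingEnd ℂ (Function.Periodic.qParam h (t * I)) =
      Function.Periodic.qParam h (t * I) := by
    intro h
    rw [Function.Periodic.qParam, ← Complex.exp_conj]
    simp [map_ofNat]
  rw [← Complex.conj_eq_iff_real, eta_eq, map_mul, hq, eulerProd,
    (ModularForm.multipliableLocallyUniformlyOn_eta.multipliable hτ).map_tprod (starRingEnd ℂ)
      Complex.continuous_conj]
  simp [ModularForm.eta_q, hq]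

lemma exists_modularLambda_eq_ofReal {t : ℝ} (ht : 0 < t) :
    ∃ x : ℝ, 0 < x ∧ x < 1 ∧ modularLambda (t * I) = x := by
  obtain ⟨a, ha, ha'⟩ := exists_pos_theta2_pow_four ht
  obtain ⟨b, hb, hb'⟩ := exists_pos_theta3_pow_four ht
  obtain ⟨c, hc, hc'⟩ := exists_pos_theta4_pow_four ht
  have hJ := jacobi_identity (im_ofReal_mul_I_pos ht)
  rw [ha', hb', hc'] at hJ
  have hJ' : b = a + c := by exact_mod_cast hJ
  refine ⟨a / b, by positivity, (div_lt_one hb).2 (by linarith), ?_⟩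
  rw [modularLambda, ha', hb']
  push_cast
  rfl

lemma exists_cubeRoot_eq_ofReal {t : ℝ} (ht : 0 < t) :
    ∃ ρ : ℝ, 0 < ρ ∧ cubeRoot (t * I) = ρ := by
  obtain ⟨a, ha, ha'⟩ := exists_pos_eta_pow_four ht
  obtain ⟨b, hb, hb'⟩ := exists_pos_theta3_pow_four ht
  refine ⟨2 * a / b, by positivity, ?_⟩
  rw [cubeRoot, ha', hb']
  push_cast
  rfl

lemma isOpen_norm_modularLambda_lt_one : IsOpen {τ : ℂ | 0 < τ.im ∧ ‖modularLambda τ‖ < 1} :=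
  differentiableOn_modularLambda.continuousOn.norm.isOpen_inter_preimage isOpen_im_pos isOpen_Iio

lemma isOpen_cuspDomain : IsOpen cuspDomain := isOpen_norm_modularLambda_lt_one.connectedComponentIn

lemma cuspDomain_subset : cuspDomain ⊆ {τ : ℂ | 0 < τ.im ∧ ‖modularLambda τ‖ < 1} :=
  connectedComponentIn_subset _ _

/-- The positive imaginary axis, as a subset of the complex plane. -/
def imAxis : Set ℂ := (fun t : ℝ => (t : ℂ) * I) '' Set.Ioi 0

lemma I_mem_imAxis : I ∈ imAxis := ⟨1, Set.mem_Ioi.2 one_pos, by simp⟩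

lemma isPreconnected_imAxis : IsPreconnected imAxis :=
  isPreconnected_Ioi.image _ (by fun_prop)

lemma imAxis_subset : imAxis ⊆ {τ : ℂ | 0 < τ.im ∧ ‖modularLambda τ‖ < 1} := by
  rintro _ ⟨t, ht, rfl⟩
  obtain ⟨x, hx0, hx1, hx⟩ := exists_modularLambda_eq_ofReal ht
  refine ⟨im_ofReal_mul_I_pos ht, ?_⟩
  change ‖modularLambda (t * I)‖ < 1
  rwa [hx, Complex.norm_real, Real.norm_of_nonneg hx0.le]

lemma ofReal_mul_I_mem_cuspDomain {t : ℝ} (ht : 0 < t) : (t : ℂ) * I ∈ cuspDomain :=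
  isPreconnected_imAxis.subset_connectedComponentIn I_mem_imAxis imAxis_subset ⟨t, ht, rfl⟩

/-- A half-plane near the cusp lies in `{|λ| < 1}`, and it is joined to `i` by the imaginary
axis. -/
lemma exists_halfPlane_subset_cuspDomain : ∃ Y : ℝ, ∀ τ : ℂ, Y < τ.im → τ ∈ cuspDomain := by
  have h := (Metric.tendsto_nhds.1 tendsto_modularLambda_imInfty) 1 one_pos
  rw [eventually_comap, eventually_atTop] at h
  obtain ⟨Y, hY⟩ := h
  refine ⟨max Y 0, fun τ hτ => ?_⟩
  have hconn : IsPreconnected ({τ : ℂ | max Y 0 < τ.im} ∪ imAxis) := by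
    refine IsPreconnected.union (((max Y 0 + 1 : ℝ) : ℂ) * I) 
      (by simp only [Set.mem_ofPred_eq, im_ofReal_mul, I_im]; linarith)
      ⟨_, Set.mem_Ioi.2 (by positivity), rfl⟩
      (convex_halfSpace_im_gt _).isPreconnected isPreconnected_imAxis
  refine hconn.subset_connectedComponentIn (Or.inr I_mem_imAxis) ?_ (Or.inl hτ)
  refine Set.union_subset (fun w (hw : max Y 0 < w.im) => ?_) imAxis_subset
  exact ⟨(le_max_right _ _).trans_lt hw,
    by simpa using hY w.im ((le_max_left _ _).trans hw.le) w rfl⟩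

/-- Both sides are primitives of `η⁴` on the connected open set `cuspDomain`, and both vanish at
the cusp. -/
theorem etaFourPrimitive_eq {τ : ℂ} (hτ : τ ∈ cuspDomain) :
    etaFourPrimitive τ =
      3 / (2 * Real.pi * I) * cubeRoot τ * tailSeries 1 (modularLambda τ) := by
  set D : ℂ → ℂ := fun τ => etaFourPrimitive τ -
    3 / (2 * Real.pi * I) * cubeRoot τ * tailSeries 1 (modularLambda τ) with hD
  have hder : ∀ w ∈ cuspDomain, HasDerivAt D 0 w := by
    intro w hw
    obtain ⟨h1, h2⟩ := cuspDomain_subset hw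
    exact ((hasDerivAt_etaFourPrimitive h1).sub
      (hasDerivAt_cubeRoot_mul_tailSeries h1 h2)).congr_deriv (sub_self _)
  have hconst : ∀ w ∈ cuspDomain, D w = D τ := fun w hw =>
    isOpen_cuspDomain.is_const_of_deriv_eq_zero isPreconnected_connectedComponentIn
      (fun x hx => (hder x hx).differentiableAt.differentiableWithinAt)
      (fun x hx => (hder x hx).deriv) hw hτ
  have hlim : Tendsto D imInfty (𝓝 0) := by
    simpa using tendsto_etaFourPrimitive_imInfty.sub tendsto_cubeRoot_mul_tailSeries_imInfty
  obtain ⟨Y, hY⟩ := exists_halfPlane_subset_cuspDomain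
  have hev : ∀ᶠ w in imInfty, D w = D τ := by
    filter_upwards [eventually_imInfty_im_gt Y] with w hw using hconst w (hY w hw)
  have : imInfty.NeBot := (tendsto_ray_imInfty 0).neBot
  have h0 : D τ = 0 := tendsto_nhds_unique (tendsto_const_nhds.congr' (hev.mono fun _ h => h.symm))
    hlim
  exact sub_eq_zero.1 h0

end Hexp

end

theorem mainTheorem3 :
    (∀ t : ℝ, 0 < t → (t : ℂ) * I ∈ Hexp.cuspDomain) ∧
    (∃ Y : ℝ, ∀ τ : ℂ, Y < τ.im → τ ∈ Hexp.cuspDomain) ∧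
    ∃ r : ℂ → ℂ,
      DifferentiableOn ℂ r Hexp.cuspDomain ∧
      (∀ τ ∈ Hexp.cuspDomain,
        r τ ^ 3 = 1 / 2 * (Hexp.modularLambda τ * (1 - Hexp.modularLambda τ))) ∧
      (∀ t : ℝ, 0 < t → ∃ ρ : ℝ, 0 < ρ ∧ r ((t : ℂ) * I) = (ρ : ℂ)) ∧
      ∀ τ ∈ Hexp.cuspDomain,
        IntegrableOn (fun t : ℝ => ModularForm.eta (τ + t * I) ^ 4 * I) (Set.Ioi 0) ∧
        ∃ L : ℂ, Hexp.ConvergesTo (Hexp.gaussFraction (Hexp.modularLambda τ)) L ∧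
          Hexp.etaFourPrimitive τ = 3 / (2 * Real.pi * I) * r τ * L := by
  refine ⟨fun t ht => Hexp.ofReal_mul_I_mem_cuspDomain ht,
    Hexp.exists_halfPlane_subset_cuspDomain, Hexp.cubeRoot,
    Hexp.differentiableOn_cubeRoot.mono fun τ hτ => (Hexp.cuspDomain_subset hτ).1,
    fun τ hτ => Hexp.cubeRoot_pow_three (Hexp.cuspDomain_subset hτ).1,
    fun t ht => Hexp.exists_cubeRoot_eq_ofReal ht, fun τ hτ => ?_⟩
  obtain ⟨him, hl⟩ := Hexp.cuspDomain_subset hτ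
  exact ⟨Hexp.integrableOn_eta_pow_four him, _, Hexp.gaussFraction_convergesTo hl,
    Hexp.etaFourPrimitive_eq hτ⟩
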